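/- On $\mathbb{R}^3$ put $\partial=\tfrac12(\partial_1-i\partial_2)$ and $\bar\partial=\tfrac12(\partial_1+i\partial_2)$. For an integer $M\ge 0$, a $2^M$-pole field centred at $X\in\mathbb{R}^3$ with components $A_{Mm}\in\mathbb{C}$, $-M\le m\le M$, satisfying the reality condition $A_{M(-m)}=\overline{A_{Mm}}$, is the real harmonic function on $\mathbb{R}^3\setminus\{X\}$ $$f(x)=\sum_{-M\le m\le 0}A_{Mm}\,\partial_3^{M+m}\partial^{-m}\frac1{|x-X|}+\sum_{1\le m\le M}A_{Mm}\,\partial_3^{M-m}\bar\partial^{\,m}\frac1{|x-X|};$$ it is non-trivial if some $A_{Mm}\neq0$. The interaction pairing (interaction energy) of two fields is $$\langle f,g\rangle=\int_{x_3=0}\bigl(g\,\partial_3f-f\,\partial_3g\bigr)\,dx_1\,dx_2 .$$ Theorem. Let $M,N\ge0$ be integers, and let $A=(A_{Mm})$ and $B=(B_{Nn})$ be the components, satisfying the reality condition and not all zero, of a $2^M$-pole and of a $2^N$-pole. For $R>0$ let $f_M$ be the $2^M$-pole field with components $A$ centred at $X_+=(0,0,R/2)$, let $g_N$ be the $2^N$-pole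 field with components $B$ centred at $X_-=(0,0,-R/2)$, and set $V_{MN}(R)=\langle f_M,g_N\rangle$. For $G,H\in SO(3)$ let $V_{MN}^{G,H}(R)$ be the pairing of $x\mapsto f_M(X_++G^{-1}(x-X_+))$ with $x\mapsto g_N(X_-+H^{-1}(x-X_-))$, that is, of the two fields rotated about their centres. Then: (1) for every $R>0$ the integral defining $V_{MN}(R)$ converges absolutely and $$V_{MN}(R)=4\pi\,\frac{(M+N)!}{R^{M+N+1}}\sum_{|m|\le\min(M,N)}(-1)^{N+m}\,2^{-2|m|}\,\overline{A_{Mm}}\,B_{Nm};$$ (2) if $M\le N$, there is a rotation $H\in SO(3)$, independent of $R$, such that $V_{MN}^{1,H}(R)\ne0$ for all $R>0$; if $N\le M$, there is a rotation $G\in SO(3)$, independent of $R$, such that $V_{MN}^{G,1}(R)\ne0$ for all $R>0$; (3) whenever rotations $G,H\in SO(3)$ are such that $V_{MN}^{G,H}(R_0)\neq0$ for some $R_0>0$, there is a constant $c>0$ with $|V_{MN}^{G,H}(R)|=c\,R^{-(M+N+1)}$ for all $R>0$. -/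

import Mathlib

open MeasureTheory

noncomputable section

namespace Multipole

/-- Physical space `ℝ³`; the coordinates `x₁, x₂, x₃` are `x 0, x 1, x 2`. -/
abbrev Space : Type := EuclideanSpace ℝ (Fin 3)

/-- The partial derivative of a complex-valued function in the `j`-th coordinate direction. -/
def pderiv (j : Fin 3) (f : Space → ℂ) : Space → ℂ :=
  fun x => fderiv ℝ f x (EuclideanSpace.single j 1)

/-- The complex derivative `∂ = (∂₁ - i ∂₂) / 2`. -/
def dz (f : Space → ℂ) : Space → ℂ :=
  fun x => (1 / 2 : ℂ) * (pderiv 0 f x - Complex.I * pderiv 1 f x)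

/-- The complex derivative `∂̄ = (∂₁ + i ∂₂) / 2`. -/
def dzbar (f : Space → ℂ) : Space → ℂ :=
  fun x => (1 / 2 : ℂ) * (pderiv 0 f x + Complex.I * pderiv 1 f x)

/-- The Coulomb potential `1 / |x - X|` centred at `X`. -/
def coulomb (X : Space) : Space → ℂ :=
  fun x => ((1 / ‖x - X‖ : ℝ) : ℂ)

/-- The elementary `2^M`-pole field of index `m`, for `-M ≤ m ≤ M`, centred at `X`:
`∂₃^(M-m) ∂̄^m (1/|x-X|)` if `m ≥ 1` and `∂₃^(M+m) ∂^(-m) (1/|x-X|)` if `m ≤ 0`. -/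
def basisField (M : ℕ) (m : ℤ) (X : Space) : Space → ℂ :=
  if 0 < m then (pderiv 2)^[M - m.natAbs] (dzbar^[m.natAbs] (coulomb X))
  else (pderiv 2)^[M - m.natAbs] (dz^[m.natAbs] (coulomb X))

/-- The `2^M`-pole field centred at `X` with components `A m`, `-M ≤ m ≤ M`. Only the values of
`A` at these indices matter. -/
def field (M : ℕ) (A : ℤ → ℂ) (X : Space) : Space → ℂ :=
  fun x => ∑ m ∈ Finset.Icc (-(M : ℤ)) (M : ℤ), A m * basisField M m X x

/-- The reality condition `A_{-m} = conj A_m`, `-M ≤ m ≤ M`, for the components of a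
(real-valued) `2^M`-pole field. -/
def IsRealComponents (M : ℕ) (A : ℤ → ℂ) : Prop :=
  ∀ m ∈ Finset.Icc (-(M : ℤ)) (M : ℤ), A (-m) = (starRingEnd ℂ) (A m)

/-- Not all components of the `2^M`-pole vanish. -/
def IsNontrivial (M : ℕ) (A : ℤ → ℂ) : Prop :=
  ∃ m ∈ Finset.Icc (-(M : ℤ)) (M : ℤ), A m ≠ 0

/-- The point `(0, 0, t)` on the `x₃`-axis. -/
def axisPoint (t : ℝ) : Space := EuclideanSpace.single 2 t

/-- The function `f` rotated by `G ∈ SO(3)` about the point `X`: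
`x ↦ f (X + G⁻¹ (x - X))`. -/
def rotate (X : Space) (G : Matrix.specialOrthogonalGroup (Fin 3) ℝ) (f : Space → ℂ) :
    Space → ℂ :=
  fun x => f (X + Matrix.toEuclideanLin ((G⁻¹ : Matrix.specialOrthogonalGroup (Fin 3) ℝ) :
    Matrix (Fin 3) (Fin 3) ℝ) (x - X))

/-- The density `g ∂₃f - f ∂₃g` of the interaction pairing, at the point `(p.1, p.2, 0)` of the
plane `x₃ = 0`. -/
def pairingDensity (f g : Space → ℂ) (p : ℝ × ℝ) : ℂ :=
  g !₂[p.1, p.2, 0] * pderiv 2 f !₂[p.1, p.2, 0] - f !₂[p.1, p.2, 0] * pderiv 2 g !₂[p.1, p.2, 0]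

/-- The interaction pairing `⟨f, g⟩ = ∫_{x₃ = 0} (g ∂₃f - f ∂₃g) dx₁ dx₂`. -/
def pairing (f g : Space → ℂ) : ℂ := ∫ p : ℝ × ℝ, pairingDensity f g p

/-- The interaction energy of the `2^M`-pole with components `A`, centred at `(0, 0, R/2)` and
rotated by `G` about its centre, and the `2^N`-pole with components `B`, centred at
`(0, 0, -R/2)` and rotated by `H` about its centre. -/
def energy (M N : ℕ) (A B : ℤ → ℂ) (G H : Matrix.specialOrthogonalGroup (Fin 3) ℝ) (R : ℝ) : ℂ :=
  pairing (rotate (axisPoint (R / 2)) G (field M A (axisPoint (R / 2))))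
    (rotate (axisPoint (-(R / 2))) H (field N B (axisPoint (-(R / 2)))))

end Multipole

end

/-!
Every field involved is a polynomial in the derivatives applied to a Coulomb potential: a
`2^M`-pole at `X` is `P(∂, ∂̄, ∂₃) (1/|x - X|)` with `P` homogeneous of degree `M`
(`polyField_fieldPoly`), and since `1/|x - X|` is radial, rotating the field about `X` is a linear
substitution in `P` (`polyField_comp_rot`).

The pairing is computed from its symmetries, without evaluating any integral except the one for two
unit charges (`pairing_coulomb_coulomb`). For harmonic `f` and `g`, homogeneous about points of the
axis, integrals over the plane of derivatives along the plane vanish; applied to suitable currents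
this gives

* `⟨f, ∂ⱼ g⟩ = -⟨∂ⱼ f, g⟩` (`pairing_pderiv_horizontal`, and `pairing_pderiv_vertical`, where the
  Laplace equation is used), so that all derivatives can be moved to the potential at `X₊`;
* `R ⟨∂₃ f, g⟩ = (k + l - 1) ⟨f, g⟩` for `f`, `g` of degrees `-k`, `-l`, from the behaviour under
  dilations (`sub_mul_pairing_pderiv`), which produces the factorial and the power of `R`;
* `⟨f, g⟩ = 0` unless the weights of `f` and `g` under rotations about the axis are opposite
  (`pairing_eq_zero_of_axisWeight`).

With `∂∂̄ = -∂₃²/4` on harmonic functions it follows that `⟨P(∂) F, Q(∂) G⟩` is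
`(-1)^N 4π (M + N)! / R^(M + N + 1)` times the middle coefficient of the restriction of `P Q` to the
null conic `4uv + w² = 0`, parametrized by `ζ ↦ (i/2, (i/2) ζ², ζ)` (`pairing_polyField`). This
is the interaction formula, and it also shows the exact decay for all orientations.

A rotation that makes the coefficient non-zero is sought as a product of a rotation about the
`x₃`-axis, one about the `x₁`-axis by the angle `2 arctan t`, and another one about the `x₃`-axis.
The middle one acts on the conic by the Möbius transformation `ζ ↦ (ζ - t)/(tζ + 1)`, so the
coefficient is, up to the factor `(1 + t²)^N`, a polynomial in `t`. At `t = i` the transformation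
degenerates, `iζ + 1 = i(ζ - i)`, and the polynomial becomes a product of two trigonometric
polynomials in the two outer angles (`eval_tiltPoly_I`). Their coefficients are the components of
the two fields up to non-zero factors: for the field of order `M` these are coefficients of
`(ζ - i)^(2N)`, none of which vanishes because `M ≤ N`. So for suitable outer angles the polynomial
in `t` is not zero, and some real `t` will do (`exists_rotation_coeff_ne_zero`).
-/

noncomputable section

namespace Multipole

open scoped ContDiff
open MvPolynomial (monomial)

/-! ### Partial derivatives off the centre -/

theorem pderiv_congr {X : Space} {f g : Space → ℂ} (h : Set.EqOn f g {X}ᶜ) (j : Fin 3) :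
    Set.EqOn (pderiv j f) (pderiv j g) {X}ᶜ := fun x hx => by
  have : f =ᶠ[nhds x] g := h.eventuallyEq_of_mem (isOpen_compl_singleton.mem_nhds hx)
  simp only [pderiv, this.fderiv_eq]

theorem dz_congr {X : Space} {f g : Space → ℂ} (h : Set.EqOn f g {X}ᶜ) :
    Set.EqOn (dz f) (dz g) {X}ᶜ := fun x hx => by
  simp only [dz, pderiv_congr h 0 hx, pderiv_congr h 1 hx]

theorem dzbar_congr {X : Space} {f g : Space → ℂ} (h : Set.EqOn f g {X}ᶜ) :
    Set.EqOn (dzbar f) (dzbar g) {X}ᶜ := fun x hx => by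
  simp only [dzbar, pderiv_congr h 0 hx, pderiv_congr h 1 hx]

section Smooth

variable {X x : Space} {f g : Space → ℂ}

theorem differentiableAt_of_smooth (hf : ContDiffOn ℝ ∞ f {X}ᶜ) (hx : x ≠ X) :
    DifferentiableAt ℝ f x :=
  (hf.contDiffAt (isOpen_compl_singleton.mem_nhds hx)).differentiableAt (by simp)

theorem smooth_pderiv (hf : ContDiffOn ℝ ∞ f {X}ᶜ) (j : Fin 3) :
    ContDiffOn ℝ ∞ (pderiv j f) {X}ᶜ :=
  (hf.fderiv_of_isOpen isOpen_compl_singleton (m := ∞) (by simp)).clm_apply contDiffOn_const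

theorem pderiv_comm (hf : ContDiffOn ℝ ∞ f {X}ᶜ) (hx : x ≠ X) (i j : Fin 3) :
    pderiv i (pderiv j f) x = pderiv j (pderiv i f) x := by
  have hc := hf.contDiffAt (isOpen_compl_singleton.mem_nhds hx)
  have hd : DifferentiableAt ℝ (fderiv ℝ f) x :=
    ((hf.fderiv_of_isOpen isOpen_compl_singleton (m := ∞) (by simp)).contDiffAt
      (isOpen_compl_singleton.mem_nhds hx)).differentiableAt (by simp)
  have key : ∀ i j : Fin 3, pderiv i (pderiv j f) x =
      fderiv ℝ (fderiv ℝ f) x (EuclideanSpace.single i 1) (EuclideanSpace.single j 1) := by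
    intro i j
    have := (hd.hasFDerivAt.clm_apply
      (hasFDerivAt_const (EuclideanSpace.single j (1 : ℝ)) x)).fderiv
    unfold pderiv
    rw [this]
    simp
  rw [key, key]
  exact (hc.isSymmSndFDerivAt (by simpa using ENat.LEInfty.out)).eq _ _

theorem pderiv_add (hf : ContDiffOn ℝ ∞ f {X}ᶜ) (hg : ContDiffOn ℝ ∞ g {X}ᶜ) (hx : x ≠ X)
    (j : Fin 3) : pderiv j (fun y => f y + g y) x = pderiv j f x + pderiv j g x := by
  unfold pderiv
  rw [fderiv_fun_add (differentiableAt_of_smooth hf hx) (differentiableAt_of_smooth hg hx)]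
  rfl

theorem pderiv_const_mul (hf : ContDiffOn ℝ ∞ f {X}ᶜ) (hx : x ≠ X) (c : ℂ) (j : Fin 3) :
    pderiv j (fun y => c * f y) x = c * pderiv j f x := by
  unfold pderiv
  rw [fderiv_const_mul (differentiableAt_of_smooth hf hx)]
  rfl

theorem smooth_const_mul (hf : ContDiffOn ℝ ∞ f {X}ᶜ) (c : ℂ) :
    ContDiffOn ℝ ∞ (fun y => c * f y) {X}ᶜ := contDiffOn_const.mul hf

theorem pderiv_sum {ι : Type*} (s : Finset ι) (f : ι → Space → ℂ)
    (hf : ∀ i ∈ s, ContDiffOn ℝ ∞ (f i) {X}ᶜ) (hx : x ≠ X) (j : Fin 3) :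
    pderiv j (fun y => ∑ i ∈ s, f i y) x = ∑ i ∈ s, pderiv j (f i) x := by
  unfold pderiv
  rw [fderiv_fun_sum fun i hi => differentiableAt_of_smooth (hf i hi) hx]
  simp

/-- The derivative of a coordinate function, cast to `ℂ`. -/
theorem hasFDerivAt_coord (i : Fin 3) (x : Space) :
    HasFDerivAt (fun y : Space => ((y i : ℝ) : ℂ))
      (Complex.ofRealCLM.comp (EuclideanSpace.proj i : Space →L[ℝ] ℝ)) x :=
  (Complex.ofRealCLM.comp (EuclideanSpace.proj i : Space →L[ℝ] ℝ)).hasFDerivAt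

theorem smooth_coord_mul (hf : ContDiffOn ℝ ∞ f {X}ᶜ) (i : Fin 3) :
    ContDiffOn ℝ ∞ (fun y => (y i : ℂ) * f y) {X}ᶜ :=
  (Complex.ofRealCLM.comp
    (EuclideanSpace.proj i : Space →L[ℝ] ℝ)).contDiff.contDiffOn.mul hf

theorem pderiv_coord_mul (hf : ContDiffOn ℝ ∞ f {X}ᶜ) (hx : x ≠ X) (i j : Fin 3) :
    pderiv j (fun y => (y i : ℂ) * f y) x = (if i = j then f x else 0) + x i * pderiv j f x := by
  unfold pderiv
  have := ((hasFDerivAt_coord i x).mul (differentiableAt_of_smooth hf hx).hasFDerivAt).fderiv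
  simp only [] at this
  rw [show (fun y : Space => (y i : ℂ) * f y) = (fun y : Space => ((y i : ℝ) : ℂ)) * f from rfl,
    this]
  by_cases h : i = j <;> simp [h, add_comm]

theorem fderiv_apply_eq_sum (f : Space → ℂ) (x v : Space) :
    fderiv ℝ f x v = ∑ j, (v j : ℂ) * pderiv j f x := by
  have hv : v = ∑ j, v j • EuclideanSpace.single j (1 : ℝ) := by
    ext i
    simp [Finset.sum_apply, Pi.single_apply]
  rw [congrArg (fderiv ℝ f x) hv, map_sum]
  simp [pderiv]

theorem hasDerivAt_comp_line {γ : ℝ → Space} {v : Space} {t : ℝ}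
    (hf : DifferentiableAt ℝ f (γ t)) (hγ : HasDerivAt γ v t) :
    HasDerivAt (fun s => f (γ s)) (∑ j, (v j : ℂ) * pderiv j f (γ t)) t := by
  rw [← fderiv_apply_eq_sum]
  exact hf.hasFDerivAt.comp_hasDerivAt t hγ

end Smooth

/-! ### Homogeneous harmonic fields -/

/-- A smooth harmonic function on `ℝ³ ∖ {X}` that is homogeneous of degree `-k` about `X`. Its
value at `X` is irrelevant. -/
structure IsPole (k : ℕ) (X : Space) (f : Space → ℂ) : Prop where
  smooth : ContDiffOn ℝ ∞ f {X}ᶜ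
  homog : ∀ r : ℝ, 0 < r → ∀ y : Space, y ≠ 0 → f (X + r • y) = ((r : ℂ) ^ k)⁻¹ * f (X + y)
  harm : ∀ x, x ≠ X → ∑ j, pderiv j (pderiv j f) x = 0

namespace IsPole

variable {k : ℕ} {X : Space} {f g : Space → ℂ}

theorem pderiv (hf : IsPole k X f) (j : Fin 3) : IsPole (k + 1) X (pderiv j f) where
  smooth := smooth_pderiv hf.smooth j
  homog r hr y hy := by
    have hr' : (r : ℂ) ≠ 0 := by exact_mod_cast hr.ne'
    have hX : X + y ≠ X := by simpa using hy
    have hX' : X + r • y ≠ X := by simpa [hr.ne'] using hy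
    have hγ : HasDerivAt (fun t : ℝ => X + y + t • EuclideanSpace.single j (1 : ℝ))
        (EuclideanSpace.single j (1 : ℝ)) 0 := by
      simpa using ((hasDerivAt_id (0 : ℝ)).smul_const
        (EuclideanSpace.single j (1 : ℝ) : Space)).const_add (X + y)
    have hγ' : HasDerivAt (fun t : ℝ => X + r • (y + t • EuclideanSpace.single j (1 : ℝ)))
        (r • EuclideanSpace.single j (1 : ℝ)) 0 := by
      simpa using ((((hasDerivAt_id (0 : ℝ)).smul_const
        (EuclideanSpace.single j (1 : ℝ) : Space)).const_add y).const_smul r).const_add X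
    have h1 := (hasDerivAt_comp_line (f := f) (by
      simpa using differentiableAt_of_smooth hf.smooth hX) hγ).const_mul (((r : ℂ) ^ k)⁻¹)
    have h2 := hasDerivAt_comp_line (f := f) (by
      simpa using differentiableAt_of_smooth hf.smooth hX') hγ'
    have hev : ∀ᶠ t : ℝ in nhds 0, y + t • EuclideanSpace.single j (1 : ℝ) ≠ (0 : Space) := by
      have : ContinuousAt (fun t : ℝ => y + t • (EuclideanSpace.single j (1 : ℝ) : Space)) 0 := by
        fun_prop
      exact this.eventually_ne (by simpa using hy)
    have h3 := h2.congr_of_eventuallyEq (f₁ := fun t : ℝ =>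
      ((r : ℂ) ^ k)⁻¹ * f (X + y + t • EuclideanSpace.single j (1 : ℝ))) (by
        filter_upwards [hev] with t ht
        rw [hf.homog r hr _ ht, add_assoc])
    have := h1.unique h3
    simp only [zero_smul, add_zero, PiLp.smul_apply, PiLp.single_apply, smul_eq_mul] at this
    simp [apply_ite Complex.ofReal, ite_mul] at this
    rw [pow_succ, mul_inv, mul_comm _ (r : ℂ)⁻¹, mul_assoc, this, inv_mul_cancel_left₀ hr']
  harm x hx := by
    have key : ∀ i, Multipole.pderiv i (Multipole.pderiv i (Multipole.pderiv j f)) x =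
        Multipole.pderiv j (Multipole.pderiv i (Multipole.pderiv i f)) x := fun i => by
      rw [pderiv_comm (smooth_pderiv hf.smooth i) hx j i]
      exact pderiv_congr (fun y hy => pderiv_comm hf.smooth hy i j) i hx
    simp only [key]
    rw [← pderiv_sum Finset.univ _
      (fun i _ => smooth_pderiv (smooth_pderiv hf.smooth i) i) hx j]
    rw [pderiv_congr (X := X) (g := fun _ => 0) (fun y hy => hf.harm y hy) j hx]
    simp [Multipole.pderiv]

theorem const_mul (hf : IsPole k X f) (c : ℂ) : IsPole k X (fun x => c * f x) where
  smooth := smooth_const_mul hf.smooth c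
  homog r hr y hy := by rw [hf.homog r hr y hy]; ring
  harm x hx := by
    have key : ∀ i, Multipole.pderiv i (Multipole.pderiv i fun x => c * f x) x =
        c * Multipole.pderiv i (Multipole.pderiv i f) x := fun i => by
      rw [← pderiv_const_mul (smooth_pderiv hf.smooth i) hx]
      exact pderiv_congr (fun y hy => pderiv_const_mul hf.smooth hy c i) i hx
    simp only [key, ← Finset.mul_sum, hf.harm x hx, mul_zero]

theorem add (hf : IsPole k X f) (hg : IsPole k X g) : IsPole k X (fun x => f x + g x) where
  smooth := hf.smooth.add hg.smooth
  homog r hr y hy := by rw [hf.homog r hr y hy, hg.homog r hr y hy]; ring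
  harm x hx := by
    have key : ∀ i, Multipole.pderiv i (Multipole.pderiv i fun x => f x + g x) x =
        Multipole.pderiv i (Multipole.pderiv i f) x +
          Multipole.pderiv i (Multipole.pderiv i g) x := fun i => by
      rw [← pderiv_add (smooth_pderiv hf.smooth i) (smooth_pderiv hg.smooth i) hx]
      exact pderiv_congr (fun y hy => pderiv_add hf.smooth hg.smooth hy i) i hx
    simp only [key, Finset.sum_add_distrib, hf.harm x hx, hg.harm x hx, add_zero]

theorem zero (k : ℕ) (X : Space) : IsPole k X (fun _ => 0) where
  smooth := contDiffOn_const
  homog r hr y hy := by simp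
  harm x hx := by
    have h0 : ∀ j, Multipole.pderiv j (fun _ : Space => (0 : ℂ)) = fun _ => 0 := fun j => by
      funext y
      simp [Multipole.pderiv]
    simp [h0]

theorem sum {ι : Type*} (s : Finset ι) (f : ι → Space → ℂ) (hf : ∀ i ∈ s, IsPole k X (f i)) :
    IsPole k X (fun x => ∑ i ∈ s, f i x) := by
  classical
  induction s using Finset.induction_on with
  | empty => simpa using zero k X
  | insert a s ha ih =>
    simp only [Finset.sum_insert ha]
    exact (hf a (Finset.mem_insert_self a s)).add
      (ih fun i hi => hf i (Finset.mem_insert_of_mem hi))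

theorem dz (hf : IsPole k X f) : IsPole (k + 1) X (dz f) := by
  have := ((hf.pderiv 0).add ((hf.pderiv 1).const_mul (-Complex.I))).const_mul (1 / 2)
  convert this using 1
  funext x
  simp only [Multipole.dz]
  ring

theorem dzbar (hf : IsPole k X f) : IsPole (k + 1) X (dzbar f) := by
  exact ((hf.pderiv 0).add ((hf.pderiv 1).const_mul Complex.I)).const_mul (1 / 2)

theorem pderiv_dzbar (hf : IsPole k X f) {x : Space} (hx : x ≠ X) (j : Fin 3) :
    Multipole.pderiv j (Multipole.dzbar f) x =
      1 / 2 * (Multipole.pderiv j (Multipole.pderiv 0 f) x +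
        Complex.I * Multipole.pderiv j (Multipole.pderiv 1 f) x) := by
  rw [← pderiv_const_mul (hf.pderiv 1).smooth hx,
    ← pderiv_add (hf.pderiv 0).smooth ((hf.pderiv 1).const_mul _).smooth hx,
    ← pderiv_const_mul ((hf.pderiv 0).add ((hf.pderiv 1).const_mul _)).smooth hx]
  rfl

theorem pderiv_dz (hf : IsPole k X f) {x : Space} (hx : x ≠ X) (j : Fin 3) :
    Multipole.pderiv j (Multipole.dz f) x =
      1 / 2 * (Multipole.pderiv j (Multipole.pderiv 0 f) x -
        Complex.I * Multipole.pderiv j (Multipole.pderiv 1 f) x) := by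
  rw [sub_eq_add_neg, ← neg_mul, ← pderiv_const_mul (hf.pderiv 1).smooth hx,
    ← pderiv_add (hf.pderiv 0).smooth ((hf.pderiv 1).const_mul _).smooth hx,
    ← pderiv_const_mul ((hf.pderiv 0).add ((hf.pderiv 1).const_mul _)).smooth hx]
  congr 1
  funext y
  simp only [Multipole.dz]
  ring

theorem dz_pderiv_two (hf : IsPole k X f) :
    Set.EqOn (Multipole.dz (Multipole.pderiv 2 f)) (Multipole.pderiv 2 (Multipole.dz f)) {X}ᶜ :=
  fun x hx => by
    rw [hf.pderiv_dz hx, Multipole.dz, pderiv_comm hf.smooth hx 2 0, pderiv_comm hf.smooth hx 2 1]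

theorem dzbar_pderiv_two (hf : IsPole k X f) :
    Set.EqOn (Multipole.dzbar (Multipole.pderiv 2 f)) (Multipole.pderiv 2 (Multipole.dzbar f))
      {X}ᶜ :=
  fun x hx => by
    rw [hf.pderiv_dzbar hx, Multipole.dzbar, pderiv_comm hf.smooth hx 2 0,
      pderiv_comm hf.smooth hx 2 1]

/-- The factorization `∂∂̄ = (∂₁² + ∂₂²)/4` of the Laplacian of the plane, for harmonic `f`. -/
theorem dz_dzbar_eq (hf : IsPole k X f) :
    Set.EqOn (Multipole.dz (Multipole.dzbar f))
      (fun x => (-1 / 4) * Multipole.pderiv 2 (Multipole.pderiv 2 f) x) {X}ᶜ := fun x hx => by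
  have h := hf.harm x hx
  rw [Fin.sum_univ_three] at h
  rw [Multipole.dz]
  simp only [hf.pderiv_dzbar hx, pderiv_comm hf.smooth hx 1 0]
  linear_combination (1 / 4) * h -
    (1 / 4) * Multipole.pderiv 1 (Multipole.pderiv 1 f) x * Complex.I_sq

theorem dz_dzbar_comm (hf : IsPole k X f) :
    Set.EqOn (Multipole.dz (Multipole.dzbar f)) (Multipole.dzbar (Multipole.dz f)) {X}ᶜ :=
  fun x hx => by
    rw [Multipole.dz, hf.pderiv_dzbar hx, hf.pderiv_dzbar hx, Multipole.dzbar, hf.pderiv_dz hx,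
      hf.pderiv_dz hx, pderiv_comm hf.smooth hx 1 0]
    ring

/-- Euler's identity for a function homogeneous about `X`. -/
theorem euler (hf : IsPole k X f) {x : Space} (hx : x ≠ X) :
    ∑ j, ((x j - X j : ℝ) : ℂ) * Multipole.pderiv j f x = -k * f x := by
  have hy : x - X ≠ 0 := sub_ne_zero.mpr hx
  have hγ : HasDerivAt (fun t : ℝ => X + t • (x - X)) (x - X) 1 := by
    simpa using ((hasDerivAt_id (1 : ℝ)).smul_const (x - X)).const_add X
  have h1 := hasDerivAt_comp_line (f := f)
    (by simpa using differentiableAt_of_smooth hf.smooth hx) hγ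
  have h2 : HasDerivAt (fun t : ℝ => ((t : ℂ) ^ k)⁻¹ * f x) (-k * f x) 1 := by
    have := ((((hasDerivAt_id (1 : ℝ)).ofReal_comp).pow k).inv (by simp)).mul_const (f x)
    simpa using this
  have h3 := h2.congr_of_eventuallyEq (f₁ := fun t : ℝ => f (X + t • (x - X))) (by
    filter_upwards [lt_mem_nhds (show (0 : ℝ) < 1 by norm_num)] with t ht
    rw [hf.homog t ht _ hy, add_sub_cancel])
  have := h1.unique h3
  simpa using this

/-- A homogeneous field is bounded by its decay rate. -/
theorem exists_bound (hf : IsPole k X f) :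
    ∃ C : ℝ, 0 ≤ C ∧ ∀ x, x ≠ X → ‖f x‖ ≤ C / ‖x - X‖ ^ k := by
  have hc : ContinuousOn f (Metric.sphere X 1) := hf.smooth.continuousOn.mono fun x hx => by
    rintro rfl
    simp at hx
  obtain ⟨C, hC⟩ := (isCompact_sphere X 1).exists_bound_of_continuousOn hc
  refine ⟨max C 0, le_max_right _ _, fun x hx => ?_⟩
  have hn : 0 < ‖x - X‖ := norm_pos_iff.mpr (sub_ne_zero.mpr hx)
  have hy : ‖x - X‖⁻¹ • (x - X) ≠ 0 := smul_ne_zero (inv_ne_zero hn.ne') (sub_ne_zero.mpr hx)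
  have h := hf.homog ‖x - X‖ hn _ hy
  rw [smul_smul, mul_inv_cancel₀ hn.ne', one_smul, add_sub_cancel] at h
  rw [h, norm_mul, norm_inv, norm_pow, Complex.norm_real, norm_norm, inv_mul_eq_div]
  gcongr
  refine (hC _ ?_).trans (le_max_left _ _)
  simp [norm_smul, hn.ne']

end IsPole

/-! ### The Coulomb potential -/

theorem normSq_eq (x : Space) : ‖x‖ ^ 2 = x 0 ^ 2 + x 1 ^ 2 + x 2 ^ 2 := by
  rw [EuclideanSpace.real_norm_sq_eq, Fin.sum_univ_three]

theorem smooth_inv_norm_pow (n : ℕ) (X : Space) :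
    ContDiffOn ℝ ∞ (fun x : Space => (((‖x - X‖ ^ n)⁻¹ : ℝ) : ℂ)) {X}ᶜ := by
  intro x hx
  have hx' : x - X ≠ 0 := sub_ne_zero.mpr hx
  have h1 : ContDiffAt ℝ ∞ (fun x : Space => ‖x - X‖) x :=
    (contDiffAt_id.sub contDiffAt_const).norm ℝ hx'
  have h2 := (h1.pow n).inv (pow_ne_zero _ (norm_ne_zero_iff.mpr hx'))
  exact (Complex.ofRealCLM.contDiff.contDiffAt.comp x h2).contDiffWithinAt

theorem pderiv_inv_norm_pow (n : ℕ) {X x : Space} (hx : x ≠ X) (j : Fin 3) :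
    pderiv j (fun x : Space => (((‖x - X‖ ^ n)⁻¹ : ℝ) : ℂ)) x =
      -n * ((x j - X j : ℝ) : ℂ) * (((‖x - X‖ ^ (n + 2))⁻¹ : ℝ) : ℂ) := by
  have hx' : x - X ≠ 0 := sub_ne_zero.mpr hx
  have hn : ‖x - X‖ ≠ 0 := norm_ne_zero_iff.mpr hx'
  have hγ : HasDerivAt (fun t : ℝ => x + t • EuclideanSpace.single j (1 : ℝ))
      (EuclideanSpace.single j (1 : ℝ)) 0 := by
    simpa using ((hasDerivAt_id (0 : ℝ)).smul_const
      (EuclideanSpace.single j (1 : ℝ) : Space)).const_add x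
  have h1 := hasDerivAt_comp_line (f := fun x : Space => (((‖x - X‖ ^ n)⁻¹ : ℝ) : ℂ)) (by
      simpa using differentiableAt_of_smooth (smooth_inv_norm_pow n X) hx) hγ
  -- the distance to `X` along the coordinate line through `x`
  have h2 : HasDerivAt (fun t : ℝ => ‖x + t • EuclideanSpace.single j (1 : ℝ) - X‖ ^ 2)
      (2 * (x j - X j)) 0 := by
    have := (hγ.sub_const X).norm_sq
    convert this using 1
    simp [EuclideanSpace.inner_single_right]
  have h3 : HasDerivAt (fun t : ℝ => ‖x + t • EuclideanSpace.single j (1 : ℝ) - X‖)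
      ((x j - X j) / ‖x - X‖) 0 := by
    have := h2.sqrt (by simpa using pow_ne_zero 2 hn)
    simp only [Real.sqrt_sq (norm_nonneg _)] at this
    convert this using 1
    simp
    field_simp
  have h4 : HasDerivAt (fun t : ℝ =>
      (((‖x + t • EuclideanSpace.single j (1 : ℝ) - X‖ ^ n)⁻¹ : ℝ) : ℂ)) _ 0 :=
    ((h3.fun_pow n).fun_inv (by simpa using pow_ne_zero n hn)).ofReal_comp
  have := h1.unique h4
  simp only [zero_smul, add_zero, PiLp.single_apply] at this
  simp [apply_ite Complex.ofReal, ite_mul] at this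
  rw [show (fun x : Space => (((‖x - X‖ ^ n)⁻¹ : ℝ) : ℂ)) =
    fun x : Space => ((‖x - X‖ : ℂ) ^ n)⁻¹ by funext; simp, this]
  have hn' : (‖x - X‖ : ℂ) ≠ 0 := by exact_mod_cast hn
  rcases n with _ | n
  · simp
  · push_cast
    field_simp
    ring

theorem coulomb_eq (X : Space) :
    coulomb X = fun x : Space => (((‖x - X‖ ^ 1)⁻¹ : ℝ) : ℂ) := by
  funext x
  simp [coulomb]

theorem pderiv_coulomb {X x : Space} (hx : x ≠ X) (j : Fin 3) :
    pderiv j (coulomb X) x = -((x j - X j : ℝ) : ℂ) * (((‖x - X‖ ^ 3)⁻¹ : ℝ) : ℂ) := by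
  rw [coulomb_eq, pderiv_inv_norm_pow 1 hx j]
  simp

theorem isPole_coulomb (X : Space) : IsPole 1 X (coulomb X) where
  smooth := by
    rw [coulomb_eq]
    exact smooth_inv_norm_pow 1 X
  homog r hr y hy := by
    simp [coulomb, norm_smul, abs_of_pos hr, mul_comm]
  harm x hx := by
    have hs := smooth_inv_norm_pow 3 X
    have hn : (‖x - X‖ : ℂ) ≠ 0 := by
      exact_mod_cast norm_ne_zero_iff.mpr (sub_ne_zero.mpr hx)
    have key : ∀ j, pderiv j (pderiv j (coulomb X)) x =
        -(((‖x - X‖ ^ 3)⁻¹ : ℝ) : ℂ) +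
          3 * ((x j - X j : ℝ) : ℂ) ^ 2 * (((‖x - X‖ ^ 5)⁻¹ : ℝ) : ℂ) := by
      intro j
      have e : Set.EqOn (pderiv j (coulomb X)) (fun y => (-1) *
          ((y j : ℂ) * (((‖y - X‖ ^ 3)⁻¹ : ℝ) : ℂ)) +
            (X j : ℂ) * (((‖y - X‖ ^ 3)⁻¹ : ℝ) : ℂ)) {X}ᶜ := fun y hy => by
        simp only [pderiv_coulomb hy j]
        push_cast
        ring
      rw [pderiv_congr e j hx, pderiv_add (smooth_const_mul (smooth_coord_mul hs j) _)
        (smooth_const_mul hs _) hx, pderiv_const_mul (smooth_coord_mul hs j) hx,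
        pderiv_const_mul hs hx, pderiv_coord_mul hs hx, if_pos rfl,
        pderiv_inv_norm_pow 3 hx j]
      push_cast
      ring
    simp only [key, Finset.sum_add_distrib, Fin.sum_univ_three]
    have h2 : (‖x - X‖ : ℂ) ^ 2 =
        (x 0 - X 0 : ℂ) ^ 2 + (x 1 - X 1 : ℂ) ^ 2 + (x 2 - X 2 : ℂ) ^ 2 := by
      exact_mod_cast normSq_eq (x - X)
    push_cast
    field_simp
    rw [h2]
    ring

/-! ### Integration over the plane `x₃ = 0` -/

/-- The point `(p.1, p.2, 0)` of the plane `x₃ = 0`. -/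
def planePoint (p : ℝ × ℝ) : Space := !₂[p.1, p.2, 0]

/-- A continuous function on `ℝ²` that is `O((1 + |p|)^(-k))`. -/
structure PlaneDecay (k : ℕ) (φ : ℝ × ℝ → ℂ) : Prop where
  cont : Continuous φ
  bound : ∃ C : ℝ, 0 ≤ C ∧ ∀ p, ‖φ p‖ ≤ C / (1 + ‖p‖) ^ k

namespace PlaneDecay

variable {k l : ℕ} {φ ψ : ℝ × ℝ → ℂ}

theorem add (hφ : PlaneDecay k φ) (hψ : PlaneDecay k ψ) :
    PlaneDecay k (fun p => φ p + ψ p) where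
  cont := hφ.cont.add hψ.cont
  bound := by
    obtain ⟨C, hC0, hC⟩ := hφ.bound
    obtain ⟨D, hD0, hD⟩ := hψ.bound
    refine ⟨C + D, by positivity, fun p => (norm_add_le _ _).trans ?_⟩
    rw [add_div]
    exact add_le_add (hC p) (hD p)

theorem neg (hφ : PlaneDecay k φ) : PlaneDecay k (fun p => -φ p) where
  cont := hφ.cont.neg
  bound := by simpa using hφ.bound

theorem sub (hφ : PlaneDecay k φ) (hψ : PlaneDecay k ψ) :
    PlaneDecay k (fun p => φ p - ψ p) := by
  simpa [sub_eq_add_neg] using hφ.add hψ.neg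

theorem mul (hφ : PlaneDecay k φ) (hψ : PlaneDecay l ψ) :
    PlaneDecay (k + l) (fun p => φ p * ψ p) where
  cont := hφ.cont.mul hψ.cont
  bound := by
    obtain ⟨C, hC0, hC⟩ := hφ.bound
    obtain ⟨D, hD0, hD⟩ := hψ.bound
    refine ⟨C * D, by positivity, fun p => ?_⟩
    rw [norm_mul, pow_add, ← div_mul_div_comm]
    exact mul_le_mul (hC p) (hD p) (norm_nonneg _) (by positivity)

theorem mono (hφ : PlaneDecay l φ) (h : k ≤ l) : PlaneDecay k φ where
  cont := hφ.cont
  bound := by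
    obtain ⟨C, hC0, hC⟩ := hφ.bound
    refine ⟨C, hC0, fun p => (hC p).trans ?_⟩
    have : 1 ≤ 1 + ‖p‖ := by linarith [norm_nonneg p]
    gcongr

theorem mul_of_le {q : ℝ × ℝ → ℝ} (hq : Continuous q) (hq' : ∀ p, ‖q p‖ ≤ ‖p‖)
    (hφ : PlaneDecay (k + 1) φ) : PlaneDecay k (fun p => (q p : ℂ) * φ p) where
  cont := (Complex.continuous_ofReal.comp hq).mul hφ.cont
  bound := by
    obtain ⟨C, hC0, hC⟩ := hφ.bound
    refine ⟨C, hC0, fun p => ?_⟩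
    have h0 : 0 < 1 + ‖p‖ := by positivity
    rw [norm_mul, Complex.norm_real]
    calc ‖q p‖ * ‖φ p‖ ≤ (1 + ‖p‖) * (C / (1 + ‖p‖) ^ (k + 1)) :=
          mul_le_mul ((hq' p).trans (by linarith)) (hC p) (norm_nonneg _) h0.le
      _ = C / (1 + ‖p‖) ^ k := by
          field_simp
          ring

theorem fst_mul (hφ : PlaneDecay (k + 1) φ) : PlaneDecay k (fun p => (p.1 : ℂ) * φ p) :=
  mul_of_le continuous_fst norm_fst_le hφ

theorem snd_mul (hφ : PlaneDecay (k + 1) φ) : PlaneDecay k (fun p => (p.2 : ℂ) * φ p) :=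
  mul_of_le continuous_snd norm_snd_le hφ

theorem integrable (hφ : PlaneDecay k φ) (hk : 3 ≤ k) : Integrable φ := by
  obtain ⟨C, hC0, hC⟩ := (hφ.mono hk).bound
  have h := (integrable_one_add_norm (E := ℝ × ℝ) (μ := volume) (r := 3) (by
    simp; norm_num)).const_mul C
  refine h.mono' hφ.cont.aestronglyMeasurable (Filter.Eventually.of_forall fun p => ?_)
  have h0 : 0 ≤ 1 + ‖p‖ := by positivity
  refine (hC p).trans_eq ?_
  rw [Real.rpow_neg h0, div_eq_mul_inv, ← Real.rpow_natCast]
  norm_cast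

theorem tendsto_comp {γ : ℝ → ℝ × ℝ} {l : Filter ℝ} (hφ : PlaneDecay k φ) (hk : 1 ≤ k)
    (hγ : ∀ t, |t| ≤ ‖γ t‖) (hl : Filter.Tendsto (fun t : ℝ => |t|) l Filter.atTop) :
    Filter.Tendsto (fun t => φ (γ t)) l (nhds 0) := by
  obtain ⟨C, hC0, hC⟩ := (hφ.mono hk).bound
  have h1 : Filter.Tendsto (fun t : ℝ => C / (1 + |t|)) l (nhds 0) :=
    (Filter.tendsto_atTop_add_const_left _ _ hl).const_div_atTop C
  refine squeeze_zero_norm (fun t => (hC _).trans ?_) h1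
  rw [pow_one]
  gcongr
  exact hγ t

/-- The integral over the plane of a derivative in the first direction vanishes. -/
theorem integral_fst (hφ : PlaneDecay 1 φ) (hψ : PlaneDecay 3 ψ)
    (h : ∀ p : ℝ × ℝ, HasDerivAt (fun t => φ (t, p.2)) (ψ p) p.1) : ∫ p, ψ p = 0 := by
  have hi := hψ.integrable le_rfl
  rw [Measure.volume_eq_prod] at hi ⊢
  rw [integral_prod_symm _ hi]
  refine integral_eq_zero_of_ae ?_
  filter_upwards [hi.prod_left_ae] with y hy
  have := integral_of_hasDerivAt_of_tendsto (f := fun t => φ (t, y)) (f' := fun t => ψ (t, y))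
    (m := 0) (n := 0) (fun x => h (x, y)) hy
    (hφ.tendsto_comp le_rfl (fun t => norm_fst_le (t, y)) Filter.tendsto_abs_atBot_atTop)
    (hφ.tendsto_comp le_rfl (fun t => norm_fst_le (t, y)) Filter.tendsto_abs_atTop_atTop)
  simpa using this

/-- The integral over the plane of a derivative in the second direction vanishes. -/
theorem integral_snd (hφ : PlaneDecay 1 φ) (hψ : PlaneDecay 3 ψ)
    (h : ∀ p : ℝ × ℝ, HasDerivAt (fun t => φ (p.1, t)) (ψ p) p.2) : ∫ p, ψ p = 0 := by
  have hi := hψ.integrable le_rfl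
  rw [Measure.volume_eq_prod] at hi ⊢
  rw [integral_prod _ hi]
  refine integral_eq_zero_of_ae ?_
  filter_upwards [hi.prod_right_ae] with x hx
  have := integral_of_hasDerivAt_of_tendsto (f := fun t => φ (x, t)) (f' := fun t => ψ (x, t))
    (m := 0) (n := 0) (fun y => h (x, y)) hx
    (hφ.tendsto_comp le_rfl (fun t => norm_snd_le (x, t)) Filter.tendsto_abs_atBot_atTop)
    (hφ.tendsto_comp le_rfl (fun t => norm_snd_le (x, t)) Filter.tendsto_abs_atTop_atTop)
  simpa using this

end PlaneDecay

/-! ### Restriction of a field to the plane -/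

section Restriction

variable {h : ℝ}

theorem planePoint_ne (hh : h ≠ 0) (p : ℝ × ℝ) : planePoint p ≠ axisPoint h := fun e => by
  have := congrArg (fun x : Space => x 2) e
  simp [planePoint, axisPoint] at this
  exact hh this.symm

theorem planePoint_sub_normSq (h : ℝ) (p : ℝ × ℝ) :
    ‖planePoint p - axisPoint h‖ ^ 2 = p.1 ^ 2 + p.2 ^ 2 + h ^ 2 := by
  rw [normSq_eq]
  simp [planePoint, axisPoint]

theorem continuous_planePoint : Continuous planePoint := by
  unfold planePoint
  fun_prop

theorem hasDerivAt_planePoint_fst (p : ℝ × ℝ) :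
    HasDerivAt (fun t => planePoint (t, p.2)) (EuclideanSpace.single 0 (1 : ℝ)) p.1 := by
  have h := ((hasDerivAt_id p.1).smul_const (EuclideanSpace.single 0 (1 : ℝ) : Space)).add_const
    (planePoint (0, p.2))
  have e : (fun t => planePoint (t, p.2)) = fun t : ℝ =>
      t • (EuclideanSpace.single 0 (1 : ℝ) : Space) + planePoint (0, p.2) := by
    funext t
    ext i
    fin_cases i <;> simp [planePoint]
  rw [e]
  simpa using h

theorem hasDerivAt_planePoint_snd (p : ℝ × ℝ) :
    HasDerivAt (fun t => planePoint (p.1, t)) (EuclideanSpace.single 1 (1 : ℝ)) p.2 := by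
  have h := ((hasDerivAt_id p.2).smul_const (EuclideanSpace.single 1 (1 : ℝ) : Space)).add_const
    (planePoint (p.1, 0))
  have e : (fun t => planePoint (p.1, t)) = fun t : ℝ =>
      t • (EuclideanSpace.single 1 (1 : ℝ) : Space) + planePoint (p.1, 0) := by
    funext t
    ext i
    fin_cases i <;> simp [planePoint]
  rw [e]
  simpa using h

variable {k l : ℕ} {f g : Space → ℂ} {h' : ℝ}

theorem hasDerivAt_plane_fst (hh : h ≠ 0) (hf : IsPole k (axisPoint h) f) (p : ℝ × ℝ) :
    HasDerivAt (fun t => f (planePoint (t, p.2))) (pderiv 0 f (planePoint p)) p.1 := by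
  have := hasDerivAt_comp_line (f := f)
    (differentiableAt_of_smooth hf.smooth (planePoint_ne hh _)) (hasDerivAt_planePoint_fst p)
  simpa [Fin.sum_univ_three] using this

theorem hasDerivAt_plane_snd (hh : h ≠ 0) (hf : IsPole k (axisPoint h) f) (p : ℝ × ℝ) :
    HasDerivAt (fun t => f (planePoint (p.1, t))) (pderiv 1 f (planePoint p)) p.2 := by
  have := hasDerivAt_comp_line (f := f)
    (differentiableAt_of_smooth hf.smooth (planePoint_ne hh _)) (hasDerivAt_planePoint_snd p)
  simpa [Fin.sum_univ_three] using this

theorem IsPole.planeDecay (hh : h ≠ 0) (hf : IsPole k (axisPoint h) f) :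
    PlaneDecay k (fun p => f (planePoint p)) where
  cont := hf.smooth.continuousOn.comp_continuous continuous_planePoint fun p => planePoint_ne hh p
  bound := by
    obtain ⟨C, hC0, hC⟩ := hf.exists_bound
    have ha : 0 < |h| := abs_pos.mpr hh
    -- `c (1 + |p|) ≤ |(p, 0) - (0, 0, h)|` for this `c`
    set c : ℝ := min 1 |h| / 2 with hc
    have hc0 : 0 < c := by positivity
    refine ⟨C / c ^ k, by positivity, fun p => (hC _ (planePoint_ne hh p)).trans ?_⟩
    have hn := planePoint_sub_normSq h p
    have h1 : ‖p‖ ≤ ‖planePoint p - axisPoint h‖ := by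
      rw [Prod.norm_def]
      refine max_le ?_ ?_
      · exact abs_le_of_sq_le_sq (by nlinarith [sq_nonneg p.2, sq_nonneg h]) (norm_nonneg _)
      · exact abs_le_of_sq_le_sq (by nlinarith [sq_nonneg p.1, sq_nonneg h]) (norm_nonneg _)
    have h2 : |h| ≤ ‖planePoint p - axisPoint h‖ :=
      abs_le_of_sq_le_sq (by nlinarith [sq_nonneg p.1, sq_nonneg p.2]) (norm_nonneg _)
    have h3 : c * (1 + ‖p‖) ≤ ‖planePoint p - axisPoint h‖ := by
      have e1 : min 1 |h| ≤ |h| := min_le_right _ _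
      have e2 : min 1 |h| * ‖p‖ ≤ 1 * ‖p‖ :=
        mul_le_mul_of_nonneg_right (min_le_left _ _) (norm_nonneg _)
      rw [hc]
      linarith
    rw [div_div, ← mul_pow]
    gcongr

theorem pairingDensity_eq (f g : Space → ℂ) (p : ℝ × ℝ) :
    pairingDensity f g p = g (planePoint p) * pderiv 2 f (planePoint p) -
      f (planePoint p) * pderiv 2 g (planePoint p) := rfl

theorem planeDecay_pairingDensity (hh : h ≠ 0) (hh' : h' ≠ 0) (hf : IsPole k (axisPoint h) f)
    (hg : IsPole l (axisPoint h') g) : PlaneDecay (k + l + 1) (pairingDensity f g) := by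
  have h1 := (hg.planeDecay hh').mul ((hf.pderiv 2).planeDecay hh)
  have h2 := (hf.planeDecay hh).mul ((hg.pderiv 2).planeDecay hh')
  rw [show l + (k + 1) = k + l + 1 by omega] at h1
  exact h1.sub h2

theorem integrable_pairingDensity (hh : h ≠ 0) (hh' : h' ≠ 0) (hf : IsPole k (axisPoint h) f)
    (hg : IsPole l (axisPoint h') g) (hkl : 2 ≤ k + l) : Integrable (pairingDensity f g) :=
  (planeDecay_pairingDensity hh hh' hf hg).integrable (by omega)

theorem hasDerivAt_pairingDensity_fst (hh : h ≠ 0) (hh' : h' ≠ 0)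
    (hf : IsPole k (axisPoint h) f) (hg : IsPole l (axisPoint h') g) (p : ℝ × ℝ) :
    HasDerivAt (fun t => pairingDensity f g (t, p.2))
      (pairingDensity (pderiv 0 f) g p + pairingDensity f (pderiv 0 g) p) p.1 := by
  have := ((hasDerivAt_plane_fst hh' hg p).fun_mul
    (hasDerivAt_plane_fst hh (hf.pderiv 2) p)).fun_sub
    ((hasDerivAt_plane_fst hh hf p).fun_mul (hasDerivAt_plane_fst hh' (hg.pderiv 2) p))
  refine this.congr_deriv ?_
  simp only [pairingDensity_eq, pderiv_comm hf.smooth (planePoint_ne hh p) 2 0,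
    pderiv_comm hg.smooth (planePoint_ne hh' p) 2 0]
  ring

theorem hasDerivAt_pairingDensity_snd (hh : h ≠ 0) (hh' : h' ≠ 0)
    (hf : IsPole k (axisPoint h) f) (hg : IsPole l (axisPoint h') g) (p : ℝ × ℝ) :
    HasDerivAt (fun t => pairingDensity f g (p.1, t))
      (pairingDensity (pderiv 1 f) g p + pairingDensity f (pderiv 1 g) p) p.2 := by
  have := ((hasDerivAt_plane_snd hh' hg p).fun_mul
    (hasDerivAt_plane_snd hh (hf.pderiv 2) p)).fun_sub
    ((hasDerivAt_plane_snd hh hf p).fun_mul (hasDerivAt_plane_snd hh' (hg.pderiv 2) p))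
  refine this.congr_deriv ?_
  simp only [pairingDensity_eq, pderiv_comm hf.smooth (planePoint_ne hh p) 2 1,
    pderiv_comm hg.smooth (planePoint_ne hh' p) 2 1]
  ring

/-- The decay of the derivative of the pairing density in a direction of the plane. -/
theorem planeDecay_pairingDensity_pderiv (hh : h ≠ 0) (hh' : h' ≠ 0)
    (hf : IsPole k (axisPoint h) f) (hg : IsPole l (axisPoint h') g) (j : Fin 3) :
    PlaneDecay (k + l + 2)
      (fun p => pairingDensity (pderiv j f) g p + pairingDensity f (pderiv j g) p) := by
  have h1 := planeDecay_pairingDensity hh hh' (hf.pderiv j) hg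
  have h2 := planeDecay_pairingDensity hh hh' hf (hg.pderiv j)
  rw [show k + 1 + l + 1 = k + l + 2 by omega] at h1
  rw [show k + (l + 1) + 1 = k + l + 2 by omega] at h2
  exact h1.add h2

end Restriction

/-! ### Conservation laws of the pairing -/

section Conservation

variable {h h' : ℝ} {k l : ℕ} {f g : Space → ℂ}

/-- The pairing is invariant under translations within the plane, in infinitesimal form. -/
theorem pairing_pderiv_horizontal (hh : h ≠ 0) (hh' : h' ≠ 0) (hf : IsPole k (axisPoint h) f)
    (hg : IsPole l (axisPoint h') g) (hkl : 2 ≤ k + l) (j : Fin 3) (hj : j = 0 ∨ j = 1) :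
    pairing f (pderiv j g) = -pairing (pderiv j f) g := by
  have hz : ∫ p, (pairingDensity (pderiv j f) g p + pairingDensity f (pderiv j g) p) = 0 := by
    rcases hj with rfl | rfl
    · exact ((planeDecay_pairingDensity hh hh' hf hg).mono (by omega)).integral_fst
        ((planeDecay_pairingDensity_pderiv hh hh' hf hg 0).mono (by omega))
        (hasDerivAt_pairingDensity_fst hh hh' hf hg)
    · exact ((planeDecay_pairingDensity hh hh' hf hg).mono (by omega)).integral_snd
        ((planeDecay_pairingDensity_pderiv hh hh' hf hg 1).mono (by omega))
        (hasDerivAt_pairingDensity_snd hh hh' hf hg)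
  rw [integral_add (integrable_pairingDensity hh hh' (hf.pderiv j) hg (by omega))
    (integrable_pairingDensity hh hh' hf (hg.pderiv j) (by omega))] at hz
  exact eq_neg_of_add_eq_zero_right hz

/-- The pairing does not depend on the height of the plane, in infinitesimal form: the vertical
derivative of the density is a divergence within the plane, because `f` and `g` are harmonic. -/
theorem pairing_pderiv_vertical (hh : h ≠ 0) (hh' : h' ≠ 0) (hf : IsPole k (axisPoint h) f)
    (hg : IsPole l (axisPoint h') g) (hkl : 2 ≤ k + l) :
    pairing f (pderiv 2 g) = -pairing (pderiv 2 f) g := by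
  -- the components of the current `g ∇f - f ∇g` in the plane and their derivatives
  set W : Fin 3 → ℝ × ℝ → ℂ := fun j p =>
    g (planePoint p) * pderiv j f (planePoint p) - f (planePoint p) * pderiv j g (planePoint p)
  set W' : Fin 3 → ℝ × ℝ → ℂ := fun j p =>
    g (planePoint p) * pderiv j (pderiv j f) (planePoint p) -
      f (planePoint p) * pderiv j (pderiv j g) (planePoint p)
  have hW : ∀ j, PlaneDecay 1 (W j) := fun j =>
    (((hg.planeDecay hh').mul ((hf.pderiv j).planeDecay hh)).mono (by omega)).sub
      (((hf.planeDecay hh).mul ((hg.pderiv j).planeDecay hh')).mono (by omega))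
  have hW' : ∀ j, PlaneDecay 3 (W' j) := fun j =>
    (((hg.planeDecay hh').mul (((hf.pderiv j).pderiv j).planeDecay hh)).mono (by omega)).sub
      (((hf.planeDecay hh).mul (((hg.pderiv j).pderiv j).planeDecay hh')).mono (by omega))
  have h0 : ∫ p, W' 0 p = 0 := (hW 0).integral_fst (hW' 0) fun p => by
    have := ((hasDerivAt_plane_fst hh' hg p).fun_mul
      (hasDerivAt_plane_fst hh (hf.pderiv 0) p)).fun_sub
      ((hasDerivAt_plane_fst hh hf p).fun_mul (hasDerivAt_plane_fst hh' (hg.pderiv 0) p))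
    refine this.congr_deriv ?_
    simp only [W']
    ring
  have h1 : ∫ p, W' 1 p = 0 := (hW 1).integral_snd (hW' 1) fun p => by
    have := ((hasDerivAt_plane_snd hh' hg p).fun_mul
      (hasDerivAt_plane_snd hh (hf.pderiv 1) p)).fun_sub
      ((hasDerivAt_plane_snd hh hf p).fun_mul (hasDerivAt_plane_snd hh' (hg.pderiv 1) p))
    refine this.congr_deriv ?_
    simp only [W']
    ring
  have hz : ∫ p, (pairingDensity (pderiv 2 f) g p + pairingDensity f (pderiv 2 g) p) = 0 := by
    have e : ∀ p, pairingDensity (pderiv 2 f) g p + pairingDensity f (pderiv 2 g) p =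
        -(W' 0 p + W' 1 p) := fun p => by
      have e1 := hf.harm _ (planePoint_ne hh p)
      have e2 := hg.harm _ (planePoint_ne hh' p)
      rw [Fin.sum_univ_three] at e1 e2
      simp only [pairingDensity_eq, W']
      linear_combination g (planePoint p) * e1 - f (planePoint p) * e2
    simp only [e]
    rw [integral_neg, integral_add ((hW' 0).integrable le_rfl) ((hW' 1).integrable le_rfl),
      h0, h1]
    simp
  rw [integral_add (integrable_pairingDensity hh hh' (hf.pderiv 2) hg (by omega))
    (integrable_pairingDensity hh hh' hf (hg.pderiv 2) (by omega))] at hz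
  exact eq_neg_of_add_eq_zero_right hz

/-- Euler's identity on the plane: there the generator `x₁∂₁ + x₂∂₂` of the dilations acts on a
field centred at height `h` as `h ∂₃` minus the degree of homogeneity. -/
theorem IsPole.euler_plane (hh : h ≠ 0) (hf : IsPole k (axisPoint h) f) (p : ℝ × ℝ) :
    (p.1 : ℂ) * Multipole.pderiv 0 f (planePoint p) +
      p.2 * Multipole.pderiv 1 f (planePoint p) =
      -k * f (planePoint p) + h * Multipole.pderiv 2 f (planePoint p) := by
  have := hf.euler (planePoint_ne hh p)
  rw [Fin.sum_univ_three] at this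
  simp [planePoint, axisPoint] at this ⊢
  linear_combination this

/-- The behaviour of the pairing under dilations, in infinitesimal form: a vertical derivative
multiplies it by the total degree over the distance of the centres. -/
theorem sub_mul_pairing_pderiv (hh : h ≠ 0) (hh' : h' ≠ 0) (hf : IsPole k (axisPoint h) f)
    (hg : IsPole l (axisPoint h') g) (hkl : 2 ≤ k + l) :
    ((h - h' : ℝ) : ℂ) * pairing (pderiv 2 f) g = ((k + l : ℕ) - 1 : ℂ) * pairing f g := by
  have hω := planeDecay_pairingDensity hh hh' hf hg
  have hω' := planeDecay_pairingDensity_pderiv hh hh' hf hg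
  -- `D j` is the derivative of the pairing density in the direction `j`
  set D : Fin 3 → ℝ × ℝ → ℂ := fun j p =>
    pairingDensity (pderiv j f) g p + pairingDensity f (pderiv j g) p
  have d1 : PlaneDecay 3 (fun p => pairingDensity f g p + p.1 * D 0 p) :=
    (hω.mono (by omega)).add ((hω' 0).mono (show 3 + 1 ≤ _ by omega)).fst_mul
  have d2 : PlaneDecay 3 (fun p => pairingDensity f g p + p.2 * D 1 p) :=
    (hω.mono (by omega)).add ((hω' 1).mono (show 3 + 1 ≤ _ by omega)).snd_mul
  have h0 : ∫ p : ℝ × ℝ, (pairingDensity f g p + p.1 * D 0 p) = 0 :=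
    (hω.mono (show 1 + 1 ≤ _ by omega)).fst_mul.integral_fst d1 fun p => by
      have := ((hasDerivAt_id p.1).ofReal_comp).fun_mul
        (hasDerivAt_pairingDensity_fst hh hh' hf hg p)
      simpa using this
  have h1 : ∫ p : ℝ × ℝ, (pairingDensity f g p + p.2 * D 1 p) = 0 :=
    (hω.mono (show 1 + 1 ≤ _ by omega)).snd_mul.integral_snd d2 fun p => by
      have := ((hasDerivAt_id p.2).ofReal_comp).fun_mul
        (hasDerivAt_pairingDensity_snd hh hh' hf hg p)
      simpa using this
  have hz : ∫ p : ℝ × ℝ, ((pairingDensity f g p + p.1 * D 0 p) +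
      (pairingDensity f g p + p.2 * D 1 p)) = 0 := by
    rw [integral_add (d1.integrable le_rfl) (d2.integrable le_rfl), h0, h1, add_zero]
  have e : ∀ p : ℝ × ℝ, ((pairingDensity f g p + p.1 * D 0 p) +
      (pairingDensity f g p + p.2 * D 1 p)) =
      (1 - (k + l : ℕ) : ℂ) * pairingDensity f g p +
        ((h : ℂ) * pairingDensity (pderiv 2 f) g p +
          (h' : ℂ) * pairingDensity f (pderiv 2 g) p) := fun p => by
    have ef := hf.euler_plane hh p
    have eg := hg.euler_plane hh' p
    have ef' := (hf.pderiv 2).euler_plane hh p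
    have eg' := (hg.pderiv 2).euler_plane hh' p
    simp only [D, pairingDensity_eq, pderiv_comm hf.smooth (planePoint_ne hh p) 2,
      pderiv_comm hg.smooth (planePoint_ne hh' p) 2] at ef' eg' ⊢
    push_cast at ef' eg' ⊢
    linear_combination g (planePoint p) * ef' - pderiv 2 g (planePoint p) * ef +
      pderiv 2 f (planePoint p) * eg - f (planePoint p) * eg'
  simp only [e] at hz
  have i0 := integrable_pairingDensity hh hh' hf hg hkl
  have i1 := integrable_pairingDensity hh hh' (hf.pderiv 2) hg (by omega)
  have i2 := integrable_pairingDensity hh hh' hf (hg.pderiv 2) (by omega)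
  rw [integral_add (i0.const_mul _)
      (g := fun p => (h : ℂ) * pairingDensity (pderiv 2 f) g p +
        (h' : ℂ) * pairingDensity f (pderiv 2 g) p) ((i1.const_mul _).add (i2.const_mul _)),
    integral_add (i1.const_mul _) (i2.const_mul _), integral_const_mul, integral_const_mul,
    integral_const_mul] at hz
  change (1 - (k + l : ℕ) : ℂ) * pairing f g + ((h : ℂ) * pairing (pderiv 2 f) g +
    (h' : ℂ) * pairing f (pderiv 2 g)) = 0 at hz
  rw [pairing_pderiv_vertical hh hh' hf hg hkl] at hz
  push_cast at hz ⊢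
  linear_combination hz

/-- `f` is an eigenfunction, off `X`, of the generator `x₁∂₂ - x₂∂₁` of the rotations about the
`x₃`-axis. -/
def AxisWeight (μ : ℂ) (X : Space) (f : Space → ℂ) : Prop :=
  ∀ x, x ≠ X → (x 0 : ℂ) * pderiv 1 f x - x 1 * pderiv 0 f x = μ * f x

/-- The commutator of the generator of the rotations with `∂ⱼ`. -/
theorem AxisWeight.pderiv {μ : ℂ} {X : Space} (hs : ContDiffOn ℝ ∞ f {X}ᶜ)
    (hf : AxisWeight μ X f) (j : Fin 3) {x : Space} (hx : x ≠ X) :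
    (x 0 : ℂ) * Multipole.pderiv 1 (Multipole.pderiv j f) x -
      x 1 * Multipole.pderiv 0 (Multipole.pderiv j f) x =
      μ * Multipole.pderiv j f x - (if j = 0 then Multipole.pderiv 1 f x else 0) +
        (if j = 1 then Multipole.pderiv 0 f x else 0) := by
  have s0 := smooth_pderiv hs 0
  have s1 := smooth_pderiv hs 1
  have e : Set.EqOn (fun y : Space => (y 0 : ℂ) * Multipole.pderiv 1 f y +
      (-1) * ((y 1 : ℂ) * Multipole.pderiv 0 f y)) (fun y => μ * f y) {X}ᶜ := fun y hy => by
    simp only [← hf y hy]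
    ring
  have := pderiv_congr e j hx
  rw [pderiv_add (smooth_coord_mul s1 0) (smooth_const_mul (smooth_coord_mul s0 1) _) hx,
    pderiv_const_mul (smooth_coord_mul s0 1) hx, pderiv_coord_mul s1 hx, pderiv_coord_mul s0 hx,
    pderiv_const_mul hs hx] at this
  rw [pderiv_comm hs hx 1 j, pderiv_comm hs hx 0 j]
  simp only [eq_comm (a := (0 : Fin 3)), eq_comm (a := (1 : Fin 3))] at this
  rw [← this]
  ring

theorem AxisWeight.pderiv_two {μ : ℂ} {X : Space} (hs : ContDiffOn ℝ ∞ f {X}ᶜ)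
    (hf : AxisWeight μ X f) : AxisWeight μ X (Multipole.pderiv 2 f) := fun x hx => by
  simpa using hf.pderiv hs 2 hx

theorem AxisWeight.dz {μ : ℂ} {X : Space} (hf' : IsPole k X f)
    (hf : AxisWeight μ X f) : AxisWeight (μ - Complex.I) X (dz f) := fun x hx => by
  have e0 := hf.pderiv hf'.smooth 0 hx
  have e1 := hf.pderiv hf'.smooth 1 hx
  simp at e0 e1
  rw [hf'.pderiv_dz hx, hf'.pderiv_dz hx, Multipole.dz]
  linear_combination (1 / 2) * e0 - Complex.I / 2 * e1 +
    (-1 / 2) * Multipole.pderiv 1 f x * Complex.I_sq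

theorem AxisWeight.dzbar {μ : ℂ} {X : Space} (hf' : IsPole k X f)
    (hf : AxisWeight μ X f) : AxisWeight (μ + Complex.I) X (dzbar f) := fun x hx => by
  have e0 := hf.pderiv hf'.smooth 0 hx
  have e1 := hf.pderiv hf'.smooth 1 hx
  simp at e0 e1
  rw [hf'.pderiv_dzbar hx, hf'.pderiv_dzbar hx, Multipole.dzbar]
  linear_combination (1 / 2) * e0 + Complex.I / 2 * e1 +
    (-1 / 2) * Multipole.pderiv 1 f x * Complex.I_sq

theorem axisWeight_coulomb (h : ℝ) : AxisWeight 0 (axisPoint h) (coulomb (axisPoint h)) :=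
  fun x hx => by
    rw [pderiv_coulomb hx, pderiv_coulomb hx]
    simp [axisPoint]
    ring

/-- The pairing is invariant under rotations about the `x₃`-axis: it vanishes unless the weights
of the two fields add up to zero. -/
theorem pairing_eq_zero_of_axisWeight (hh : h ≠ 0) (hh' : h' ≠ 0)
    (hf : IsPole k (axisPoint h) f) (hg : IsPole l (axisPoint h') g) (hkl : 2 ≤ k + l) {μ ν : ℂ}
    (hμ : AxisWeight μ (axisPoint h) f) (hν : AxisWeight ν (axisPoint h') g) (hμν : μ + ν ≠ 0) :
    pairing f g = 0 := by
  have hω := planeDecay_pairingDensity hh hh' hf hg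
  have hω' := planeDecay_pairingDensity_pderiv hh hh' hf hg
  -- `D j` is the derivative of the pairing density in the direction `j`
  set D : Fin 3 → ℝ × ℝ → ℂ := fun j p =>
    pairingDensity (pderiv j f) g p + pairingDensity f (pderiv j g) p
  have d0 : PlaneDecay 3 (fun p => (p.2 : ℂ) * D 0 p) :=
    ((hω' 0).mono (show 3 + 1 ≤ _ by omega)).snd_mul
  have d1 : PlaneDecay 3 (fun p => (p.1 : ℂ) * D 1 p) :=
    ((hω' 1).mono (show 3 + 1 ≤ _ by omega)).fst_mul
  have h0 : ∫ p : ℝ × ℝ, (p.2 : ℂ) * D 0 p = 0 :=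
    (hω.mono (show 1 + 1 ≤ _ by omega)).snd_mul.integral_fst d0 fun p =>
      (hasDerivAt_pairingDensity_fst hh hh' hf hg p).const_mul (p.2 : ℂ)
  have h1 : ∫ p : ℝ × ℝ, (p.1 : ℂ) * D 1 p = 0 :=
    (hω.mono (show 1 + 1 ≤ _ by omega)).fst_mul.integral_snd d1 fun p =>
      (hasDerivAt_pairingDensity_snd hh hh' hf hg p).const_mul (p.1 : ℂ)
  have hz : ∫ p : ℝ × ℝ, ((p.1 : ℂ) * D 1 p - (p.2 : ℂ) * D 0 p) = 0 := by
    rw [integral_sub (d1.integrable le_rfl) (d0.integrable le_rfl), h0, h1, sub_zero]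
  have e : ∀ p : ℝ × ℝ, (p.1 : ℂ) * D 1 p - (p.2 : ℂ) * D 0 p =
      (μ + ν) * pairingDensity f g p := fun p => by
    have ef := hμ _ (planePoint_ne hh p)
    have eg := hν _ (planePoint_ne hh' p)
    have ef' := hμ.pderiv_two hf.smooth _ (planePoint_ne hh p)
    have eg' := hν.pderiv_two hg.smooth _ (planePoint_ne hh' p)
    rw [show (planePoint p) 0 = p.1 from rfl, show (planePoint p) 1 = p.2 from rfl] at *
    simp only [D, pairingDensity_eq, pderiv_comm hf.smooth (planePoint_ne hh p) 2,
      pderiv_comm hg.smooth (planePoint_ne hh' p) 2] at ef' eg' ⊢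
    linear_combination g (planePoint p) * ef' - pderiv 2 g (planePoint p) * ef +
      pderiv 2 f (planePoint p) * eg - f (planePoint p) * eg'
  simp only [e] at hz
  rw [integral_const_mul] at hz
  exact (mul_eq_zero.mp hz).resolve_left hμν

end Conservation

/-! ### Linearity of the pairing -/

section Linearity

variable {h h' : ℝ} {k l : ℕ} {f g f' g' : Space → ℂ}

theorem pairing_antisymm (f g : Space → ℂ) : pairing f g = -pairing g f := by
  unfold pairing
  rw [← integral_neg]
  congr 1
  funext p
  simp only [pairingDensity]
  ring

theorem pairingDensity_congr (hh : h ≠ 0) (hh' : h' ≠ 0)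
    (hf : Set.EqOn f f' {axisPoint h}ᶜ) (hg : Set.EqOn g g' {axisPoint h'}ᶜ) :
    pairingDensity f g = pairingDensity f' g' := by
  funext p
  have h1 := planePoint_ne hh p
  have h2 := planePoint_ne hh' p
  rw [pairingDensity_eq, pairingDensity_eq, hf h1, hg h2, pderiv_congr hf 2 h1,
    pderiv_congr hg 2 h2]

theorem pairing_congr (hh : h ≠ 0) (hh' : h' ≠ 0)
    (hf : Set.EqOn f f' {axisPoint h}ᶜ) (hg : Set.EqOn g g' {axisPoint h'}ᶜ) :
    pairing f g = pairing f' g' := by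
  unfold pairing
  rw [pairingDensity_congr hh hh' hf hg]

theorem pairing_sum_left (hh : h ≠ 0) (hh' : h' ≠ 0) {ι : Type*} (s : Finset ι) (c : ι → ℂ)
    (F : ι → Space → ℂ) (hF : ∀ i ∈ s, IsPole k (axisPoint h) (F i))
    (hg : IsPole l (axisPoint h') g) (hkl : 2 ≤ k + l) :
    pairing (fun x => ∑ i ∈ s, c i * F i x) g = ∑ i ∈ s, c i * pairing (F i) g := by
  have e : pairingDensity (fun x => ∑ i ∈ s, c i * F i x) g =
      fun p => ∑ i ∈ s, c i * pairingDensity (F i) g p := by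
    funext p
    have hp := planePoint_ne hh p
    rw [pairingDensity_eq,
      pderiv_sum s (fun i x => c i * F i x) (fun i hi => smooth_const_mul (hF i hi).smooth _) hp,
      Finset.mul_sum, Finset.sum_mul, ← Finset.sum_sub_distrib]
    refine Finset.sum_congr rfl fun i hi => ?_
    rw [pderiv_const_mul (hF i hi).smooth hp, pairingDensity_eq]
    ring
  unfold pairing
  rw [e, integral_finsetSum s fun i hi =>
    (integrable_pairingDensity hh hh' (hF i hi) hg hkl).const_mul _]
  exact Finset.sum_congr rfl fun i _ => integral_const_mul _ _

theorem pairing_sum_right (hh : h ≠ 0) (hh' : h' ≠ 0) {ι : Type*} (s : Finset ι) (c : ι → ℂ)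
    (F : ι → Space → ℂ) (hF : ∀ i ∈ s, IsPole l (axisPoint h') (F i))
    (hf : IsPole k (axisPoint h) f) (hkl : 2 ≤ k + l) :
    pairing f (fun x => ∑ i ∈ s, c i * F i x) = ∑ i ∈ s, c i * pairing f (F i) := by
  rw [pairing_antisymm, pairing_sum_left hh' hh s c F hF hf (by omega), ← Finset.sum_neg_distrib]
  refine Finset.sum_congr rfl fun i _ => ?_
  rw [pairing_antisymm f]
  ring

theorem dz_eq_sum (f : Space → ℂ) :
    dz f = fun x => ∑ i : Fin 2, (![1 / 2, -Complex.I / 2] i : ℂ) *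
      (![pderiv 0 f, pderiv 1 f] i) x := by
  funext x
  simp [dz]
  ring

theorem dzbar_eq_sum (f : Space → ℂ) :
    dzbar f = fun x => ∑ i : Fin 2, (![1 / 2, Complex.I / 2] i : ℂ) *
      (![pderiv 0 f, pderiv 1 f] i) x := by
  funext x
  simp [dzbar]
  ring

theorem pairing_dz (hh : h ≠ 0) (hh' : h' ≠ 0) (hf : IsPole k (axisPoint h) f)
    (hg : IsPole l (axisPoint h') g) (hkl : 2 ≤ k + l) :
    pairing f (dz g) = -pairing (dz f) g := by
  rw [dz_eq_sum f, dz_eq_sum g,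
    pairing_sum_left hh hh' (k := k + 1) _ _ _
      (fun i _ => by fin_cases i <;> [exact hf.pderiv 0; exact hf.pderiv 1]) hg (by omega),
    pairing_sum_right hh hh' (l := l + 1) _ _ _
      (fun i _ => by fin_cases i <;> [exact hg.pderiv 0; exact hg.pderiv 1]) hf (by omega)]
  simp only [Fin.sum_univ_two]
  simp only [Matrix.cons_val_zero, Matrix.cons_val_one,
    pairing_pderiv_horizontal hh hh' hf hg hkl 0 (Or.inl rfl),
    pairing_pderiv_horizontal hh hh' hf hg hkl 1 (Or.inr rfl)]
  ring

theorem pairing_dzbar (hh : h ≠ 0) (hh' : h' ≠ 0) (hf : IsPole k (axisPoint h) f)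
    (hg : IsPole l (axisPoint h') g) (hkl : 2 ≤ k + l) :
    pairing f (dzbar g) = -pairing (dzbar f) g := by
  rw [dzbar_eq_sum f, dzbar_eq_sum g,
    pairing_sum_left hh hh' (k := k + 1) _ _ _
      (fun i _ => by fin_cases i <;> [exact hf.pderiv 0; exact hf.pderiv 1]) hg (by omega),
    pairing_sum_right hh hh' (l := l + 1) _ _ _
      (fun i _ => by fin_cases i <;> [exact hg.pderiv 0; exact hg.pderiv 1]) hf (by omega)]
  simp only [Fin.sum_univ_two]
  simp only [Matrix.cons_val_zero, Matrix.cons_val_one,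
    pairing_pderiv_horizontal hh hh' hf hg hkl 0 (Or.inl rfl),
    pairing_pderiv_horizontal hh hh' hf hg hkl 1 (Or.inr rfl)]
  ring

end Linearity

/-! ### The derivatives `∂₃^c ∂̄^b ∂^a (1/|x - X|)` -/

/-- The derivative `∂₃^c ∂̄^b ∂^a` of the Coulomb potential centred at `X`. -/
def coulombDeriv (a b c : ℕ) (X : Space) : Space → ℂ :=
  (pderiv 2)^[c] (dzbar^[b] (dz^[a] (coulomb X)))

theorem coulombDeriv_succ_two (a b c : ℕ) (X : Space) :
    coulombDeriv a b (c + 1) X = pderiv 2 (coulombDeriv a b c X) :=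
  Function.iterate_succ_apply' _ _ _

theorem isPole_coulombDeriv (a b c : ℕ) (X : Space) :
    IsPole (a + b + c + 1) X (coulombDeriv a b c X) := by
  induction c with
  | succ c ih => rw [coulombDeriv_succ_two]; exact ih.pderiv 2
  | zero =>
    induction b with
    | succ b ih =>
      have e : coulombDeriv a (b + 1) 0 X = dzbar (coulombDeriv a b 0 X) :=
        Function.iterate_succ_apply' _ _ _
      rw [e]
      exact ih.dzbar
    | zero =>
      induction a with
      | succ a ih =>
        have e : coulombDeriv (a + 1) 0 0 X = dz (coulombDeriv a 0 0 X) :=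
          Function.iterate_succ_apply' _ _ _
        rw [e]
        exact (show a + 0 + 0 + 1 + 1 = a + 1 + 0 + 0 + 1 by omega) ▸ ih.dz
      | zero => exact isPole_coulomb X

theorem dzbar_coulombDeriv (a b c : ℕ) (X : Space) :
    Set.EqOn (dzbar (coulombDeriv a b c X)) (coulombDeriv a (b + 1) c X) {X}ᶜ := by
  induction c with
  | zero =>
    rw [show coulombDeriv a (b + 1) 0 X = dzbar (coulombDeriv a b 0 X) from
      Function.iterate_succ_apply' _ _ _]
    exact Set.eqOn_refl _ _
  | succ c ih =>
    rw [coulombDeriv_succ_two, coulombDeriv_succ_two]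
    exact (isPole_coulombDeriv a b c X).dzbar_pderiv_two.trans (pderiv_congr ih 2)

theorem dz_coulombDeriv (a b c : ℕ) (X : Space) :
    Set.EqOn (dz (coulombDeriv a b c X)) (coulombDeriv (a + 1) b c X) {X}ᶜ := by
  induction c with
  | zero =>
    induction b with
    | zero =>
      rw [show coulombDeriv (a + 1) 0 0 X = dz (coulombDeriv a 0 0 X) from
        Function.iterate_succ_apply' _ _ _]
      exact Set.eqOn_refl _ _
    | succ b ih =>
      have e : ∀ a, coulombDeriv a (b + 1) 0 X = dzbar (coulombDeriv a b 0 X) := fun a =>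
        Function.iterate_succ_apply' _ _ _
      rw [e, e]
      exact (isPole_coulombDeriv a b 0 X).dz_dzbar_comm.trans (dzbar_congr ih)
  | succ c ih =>
    rw [coulombDeriv_succ_two, coulombDeriv_succ_two]
    exact (isPole_coulombDeriv a b c X).dz_pderiv_two.trans (pderiv_congr ih 2)

theorem coulombDeriv_succ_succ (a b c : ℕ) (X : Space) :
    Set.EqOn (coulombDeriv (a + 1) (b + 1) c X)
      (fun x => (-1 / 4) * coulombDeriv a b (c + 2) X x) {X}ᶜ := fun x hx => by
  rw [← dz_coulombDeriv a (b + 1) c X hx, ← dz_congr (dzbar_coulombDeriv a b c X) hx,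
    (isPole_coulombDeriv a b c X).dz_dzbar_eq hx, coulombDeriv_succ_two, coulombDeriv_succ_two]

theorem axisWeight_coulombDeriv (a b c : ℕ) (h : ℝ) :
    AxisWeight (((b : ℂ) - a) * Complex.I) (axisPoint h) (coulombDeriv a b c (axisPoint h)) := by
  induction c with
  | succ c ih =>
    rw [coulombDeriv_succ_two]
    exact ih.pderiv_two (isPole_coulombDeriv a b c _).smooth
  | zero =>
    induction b with
    | succ b ih =>
      rw [show coulombDeriv a (b + 1) 0 (axisPoint h) = dzbar (coulombDeriv a b 0 (axisPoint h))
        from Function.iterate_succ_apply' _ _ _]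
      have := ih.dzbar (isPole_coulombDeriv a b 0 _)
      convert this using 1
      push_cast
      ring
    | zero =>
      induction a with
      | succ a ih =>
        rw [show coulombDeriv (a + 1) 0 0 (axisPoint h) = dz (coulombDeriv a 0 0 (axisPoint h))
          from Function.iterate_succ_apply' _ _ _]
        have := ih.dz (isPole_coulombDeriv a 0 0 _)
        convert this using 1
        push_cast
        ring
      | zero =>
        simpa [coulombDeriv] using axisWeight_coulomb h

/-! ### Pairings of derivatives of two Coulomb potentials -/

section Values

variable {h h' : ℝ}

/-- All derivatives of the second potential can be moved to the first. -/
theorem pairing_coulombDeriv_eq (hh : h ≠ 0) (hh' : h' ≠ 0) (a b c a' b' c' : ℕ) :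
    pairing (coulombDeriv a b c (axisPoint h)) (coulombDeriv a' b' c' (axisPoint h')) =
      (-1) ^ (a' + b' + c') *
        pairing (coulombDeriv (a + a') (b + b') (c + c') (axisPoint h))
          (coulomb (axisPoint h')) := by
  induction c' generalizing c with
  | succ c' ih =>
    rw [coulombDeriv_succ_two, pairing_pderiv_vertical hh hh' (isPole_coulombDeriv _ _ _ _)
      (isPole_coulombDeriv _ _ _ _) (by omega), ← coulombDeriv_succ_two, ih,
      show c + 1 + c' = c + (c' + 1) by omega]
    ring
  | zero =>
    induction b' generalizing b with
    | succ b' ih =>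
      rw [← pairing_congr hh hh' (Set.eqOn_refl _ _) (dzbar_coulombDeriv a' b' 0 (axisPoint h')),
        pairing_dzbar hh hh' (isPole_coulombDeriv _ _ _ _) (isPole_coulombDeriv _ _ _ _)
          (by omega),
        pairing_congr hh hh' (dzbar_coulombDeriv a b c (axisPoint h)) (Set.eqOn_refl _ _), ih,
        show b + 1 + b' = b + (b' + 1) by omega]
      ring
    | zero =>
      induction a' generalizing a with
      | succ a' ih =>
        rw [← pairing_congr hh hh' (Set.eqOn_refl _ _) (dz_coulombDeriv a' 0 0 (axisPoint h')),
          pairing_dz hh hh' (isPole_coulombDeriv _ _ _ _) (isPole_coulombDeriv _ _ _ _)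
            (by omega),
          pairing_congr hh hh' (dz_coulombDeriv a b c (axisPoint h)) (Set.eqOn_refl _ _), ih,
          show a + 1 + a' = a + (a' + 1) by omega]
        ring
      | zero => simp [coulombDeriv]

/-- The interaction of two unit charges. -/
theorem pairing_coulomb_coulomb {R : ℝ} (hR : 0 < R) :
    pairing (coulomb (axisPoint (R / 2))) (coulomb (axisPoint (-(R / 2)))) =
      4 * (Real.pi : ℂ) / R := by
  set h : ℝ := R / 2 with hh
  have h0 : 0 < h := by positivity
  have e : ∀ p : ℝ × ℝ, pairingDensity (coulomb (axisPoint h)) (coulomb (axisPoint (-h))) p =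
      ((2 * h / (p.1 ^ 2 + p.2 ^ 2 + h ^ 2) ^ 2 : ℝ) : ℂ) := fun p => by
    have n1 := planePoint_sub_normSq h p
    have n2 := planePoint_sub_normSq (-h) p
    rw [neg_sq] at n2
    have n3 : ‖planePoint p - axisPoint (-h)‖ = ‖planePoint p - axisPoint h‖ := by
      rw [← sq_eq_sq₀ (norm_nonneg _) (norm_nonneg _), n1, n2]
    have n0 : (‖planePoint p - axisPoint h‖ : ℂ) ≠ 0 := by
      exact_mod_cast norm_ne_zero_iff.mpr (sub_ne_zero.mpr (planePoint_ne h0.ne' p))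
    rw [pairingDensity_eq, pderiv_coulomb (planePoint_ne h0.ne' p),
      pderiv_coulomb (planePoint_ne (neg_ne_zero.mpr h0.ne') p), ← n1, coulomb, coulomb, n3]
    simp [planePoint, axisPoint]
    field_simp
    norm_num
  unfold pairing
  simp only [e]
  rw [integral_complex_ofReal]
  have key : ∫ p : ℝ × ℝ, 2 * h / (p.1 ^ 2 + p.2 ^ 2 + h ^ 2) ^ 2 = 4 * Real.pi / R := by
    rw [← integral_comp_polarCoord_symm]
    have e2 : ∀ p : ℝ × ℝ, p.1 • (2 * h / ((polarCoord.symm p).1 ^ 2 +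
        (polarCoord.symm p).2 ^ 2 + h ^ 2) ^ 2) =
        (p.1 * (2 * h / (p.1 ^ 2 + h ^ 2) ^ 2)) * 1 := fun p => by
      have : (polarCoord.symm p).1 ^ 2 + (polarCoord.symm p).2 ^ 2 = p.1 ^ 2 := by
        simp only [polarCoord_symm_apply]
        linear_combination p.1 ^ 2 * Real.cos_sq_add_sin_sq p.2
      rw [this, smul_eq_mul, mul_one]
    simp only [e2]
    rw [polarCoord_target, Measure.volume_eq_prod,
      setIntegral_prod_mul (fun r : ℝ => r * (2 * h / (r ^ 2 + h ^ 2) ^ 2)) (fun _ : ℝ => (1 : ℝ))]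
    have e3 : ∫ r in Set.Ioi (0 : ℝ), r * (2 * h / (r ^ 2 + h ^ 2) ^ 2) =
        0 - -h / (0 ^ 2 + h ^ 2) := by
      refine integral_Ioi_of_hasDerivAt_of_nonneg' (g := fun r : ℝ => -h / (r ^ 2 + h ^ 2))
        (fun r _ => ?_) (fun r hr => ?_) ?_
      · have hp : r ^ 2 + h ^ 2 ≠ 0 := by positivity
        have := (((hasDerivAt_id r).fun_pow 2).add_const (h ^ 2)).fun_inv hp
        have := this.const_mul (-h)
        simp only [← div_eq_mul_inv] at this
        refine this.congr_deriv ?_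
        simp
        field_simp
      · have : (0 : ℝ) < r := hr
        positivity
      · refine Filter.Tendsto.const_div_atTop ?_ _
        exact Filter.tendsto_atTop_add_const_right _ _ (Filter.tendsto_pow_atTop two_ne_zero)
    rw [e3]
    simp
    rw [max_eq_left (by positivity), show R = 2 * h by rw [hh]; ring]
    field_simp
    norm_num
  rw [key]
  push_cast
  rfl

theorem pairing_coulombDeriv_vertical {R : ℝ} (hR : 0 < R) (c : ℕ) :
    pairing (coulombDeriv 0 0 c (axisPoint (R / 2))) (coulomb (axisPoint (-(R / 2)))) =
      4 * (Real.pi : ℂ) * c.factorial / (R : ℂ) ^ (c + 1) := by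
  have h0 : R / 2 ≠ 0 := by positivity
  have hR' : (R : ℂ) ≠ 0 := by exact_mod_cast hR.ne'
  induction c with
  | zero => simpa [coulombDeriv] using pairing_coulomb_coulomb hR
  | succ c ih =>
    have := sub_mul_pairing_pderiv h0 (neg_ne_zero.mpr h0)
      (isPole_coulombDeriv 0 0 c (axisPoint (R / 2))) (isPole_coulomb (axisPoint (-(R / 2))))
      (by omega)
    rw [ih, show R / 2 - -(R / 2) = R by ring, ← coulombDeriv_succ_two] at this
    rw [← mul_right_inj' hR', this, Nat.factorial_succ]
    push_cast
    field_simp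
    ring

/-- The pairing of a derivative of the Coulomb potential with a Coulomb potential. -/
theorem pairing_coulombDeriv_coulomb {R : ℝ} (hR : 0 < R) (a b c : ℕ) :
    pairing (coulombDeriv a b c (axisPoint (R / 2))) (coulomb (axisPoint (-(R / 2)))) =
      4 * (Real.pi : ℂ) * (a + b + c).factorial / (R : ℂ) ^ (a + b + c + 1) *
        if a = b then (-1 / 4) ^ a else 0 := by
  have h0 : R / 2 ≠ 0 := by positivity
  have h0' : -(R / 2) ≠ 0 := neg_ne_zero.mpr h0
  by_cases hab : a = b
  · subst hab
    rw [if_pos rfl]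
    induction a generalizing c with
    | zero => simpa using pairing_coulombDeriv_vertical hR c
    | succ a ih =>
      rw [pairing_congr h0 h0' (coulombDeriv_succ_succ a a c _) (Set.eqOn_refl _ _)]
      have := pairing_sum_left h0 h0' {()} (fun _ => -1 / 4)
        (fun _ => coulombDeriv a a (c + 2) (axisPoint (R / 2)))
        (fun _ _ => isPole_coulombDeriv _ _ _ _) (isPole_coulomb (axisPoint (-(R / 2))))
        (by omega)
      simp only [Finset.sum_singleton] at this
      rw [this, ih, show a + a + (c + 2) = a + 1 + (a + 1) + c by omega]
      ring
  · rw [if_neg hab, mul_zero]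
    refine pairing_eq_zero_of_axisWeight h0 h0' (isPole_coulombDeriv a b c _)
      (isPole_coulomb _) (by omega) (axisWeight_coulombDeriv a b c _) (axisWeight_coulomb _) ?_
    rw [add_zero]
    refine mul_ne_zero (sub_ne_zero.mpr ?_) Complex.I_ne_zero
    exact_mod_cast Ne.symm hab

end Values

/-! ### Fields given by polynomials -/

/-- The field `P(∂, ∂̄, ∂₃) (1/|x - X|)`: the variables `X₀, X₁, X₂` of the polynomial `P` stand
for the derivatives `∂, ∂̄, ∂₃`. -/
def polyField (X : Space) : MvPolynomial (Fin 3) ℂ →ₗ[ℂ] (Space → ℂ) :=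
  (MvPolynomial.basisMonomials (Fin 3) ℂ).constr ℂ fun d => coulombDeriv (d 0) (d 1) (d 2) X

theorem polyField_monomial (X : Space) (d : Fin 3 →₀ ℕ) (c : ℂ) :
    polyField X (monomial d c) = fun x => c * coulombDeriv (d 0) (d 1) (d 2) X x := by
  have h := (MvPolynomial.basisMonomials (Fin 3) ℂ).constr_basis ℂ
    (fun d => coulombDeriv (d 0) (d 1) (d 2) X) d
  have e : monomial d c = c • (MvPolynomial.basisMonomials (Fin 3) ℂ) d := by
    simp [MvPolynomial.smul_monomial]
  rw [e, map_smul, polyField, h]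
  rfl

theorem polyField_eq_sum (X : Space) (P : MvPolynomial (Fin 3) ℂ) :
    polyField X P = fun x => ∑ d ∈ P.support, P.coeff d * coulombDeriv (d 0) (d 1) (d 2) X x := by
  conv_lhs => rw [P.as_sum, map_sum]
  funext x
  simp [Finset.sum_apply, polyField_monomial]

theorem degree_eq_of_mem_support {P : MvPolynomial (Fin 3) ℂ} {M : ℕ} (hP : P.IsHomogeneous M)
    {d : Fin 3 →₀ ℕ} (hd : d ∈ P.support) : d 0 + d 1 + d 2 = M := by
  have h := hP (MvPolynomial.mem_support_iff.mp hd)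
  rw [Finsupp.weight_apply, Finsupp.sum_fintype _ _ (by simp)] at h
  simpa [Fin.sum_univ_three] using h

theorem isPole_polyField {P : MvPolynomial (Fin 3) ℂ} {M : ℕ} (hP : P.IsHomogeneous M)
    (X : Space) : IsPole (M + 1) X (polyField X P) := by
  rw [polyField_eq_sum]
  refine IsPole.sum _ _ fun d hd => IsPole.const_mul ?_ _
  rw [← degree_eq_of_mem_support hP hd]
  exact isPole_coulombDeriv _ _ _ _

theorem smooth_polyField (P : MvPolynomial (Fin 3) ℂ) (X : Space) :
    ContDiffOn ℝ ∞ (polyField X P) {X}ᶜ := by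
  rw [polyField_eq_sum]
  exact ContDiffOn.sum fun d _ => smooth_const_mul (isPole_coulombDeriv _ _ _ _).smooth _

/-- The value of a polynomial in `∂, ∂̄, ∂₃` on the null vectors of `ℂ³`: the conic
`4uv + w² = 0`, on which homogeneous polynomials are determined modulo the Laplacian, is
parametrized by `(u, v, w) = (i/2, (i/2) ζ², ζ)`. -/
def nullEval : MvPolynomial (Fin 3) ℂ →ₐ[ℂ] Polynomial ℂ :=
  MvPolynomial.aeval ![Polynomial.C (Complex.I / 2),
    Polynomial.C (Complex.I / 2) * Polynomial.X ^ 2, Polynomial.X]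

theorem nullEval_monomial (d : Fin 3 →₀ ℕ) (c : ℂ) :
    nullEval (monomial d c) =
      Polynomial.C (c * (Complex.I / 2) ^ (d 0 + d 1)) * Polynomial.X ^ (2 * d 1 + d 2) := by
  rw [nullEval, MvPolynomial.aeval_monomial, Finsupp.prod_fintype _ _ (by simp),
    Fin.prod_univ_three]
  simp only [Matrix.cons_val_zero, Matrix.cons_val_one, Matrix.cons_val_two]
  simp only [Polynomial.algebraMap_eq, Polynomial.C_mul, Polynomial.C_pow, pow_add, mul_pow,
    pow_mul]
  simp only [Matrix.tail_cons, Matrix.head_cons]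
  ring1

theorem coeff_nullEval_monomial (d : Fin 3 →₀ ℕ) (c : ℂ) :
    (nullEval (monomial d c)).coeff (d 0 + d 1 + d 2) =
      c * if d 0 = d 1 then (-1 / 4) ^ d 0 else 0 := by
  rw [nullEval_monomial, Polynomial.coeff_C_mul_X_pow]
  by_cases h : d 0 = d 1
  · have hI : (Complex.I / 2) ^ 2 = -1 / 4 := by
      rw [div_pow, Complex.I_sq]
      norm_num
    rw [if_pos (by omega), if_pos h, ← h, ← two_mul, pow_mul, hI]
  · rw [if_neg (by omega), if_neg h, mul_zero]

/-- The pairing of two polynomial fields is given, up to a constant, by the middle coefficient of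
the product of the polynomials on the null vectors. -/
theorem pairing_polyField {R : ℝ} (hR : 0 < R) {M N : ℕ} {P Q : MvPolynomial (Fin 3) ℂ}
    (hP : P.IsHomogeneous M) (hQ : Q.IsHomogeneous N) :
    pairing (polyField (axisPoint (R / 2)) P) (polyField (axisPoint (-(R / 2))) Q) =
      (-1) ^ N * (4 * (Real.pi : ℂ) * (M + N).factorial / (R : ℂ) ^ (M + N + 1)) *
        (nullEval (P * Q)).coeff (M + N) := by
  have h0 : R / 2 ≠ 0 := by positivity
  have h0' : -(R / 2) ≠ 0 := neg_ne_zero.mpr h0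
  rw [polyField_eq_sum _ P, pairing_sum_left h0 h0' (k := M + 1) P.support
    (fun d => P.coeff d) (fun d => coulombDeriv (d 0) (d 1) (d 2) (axisPoint (R / 2)))
    (fun d hd => by
      rw [← degree_eq_of_mem_support hP hd]
      exact isPole_coulombDeriv _ _ _ _) (isPole_polyField hQ _) (by omega)]
  conv_rhs => rw [P.as_sum, Q.as_sum, Finset.sum_mul, map_sum, Polynomial.finsetSum_coeff,
    Finset.mul_sum]
  refine Finset.sum_congr rfl fun d hd => ?_
  have hd' := degree_eq_of_mem_support hP hd
  rw [polyField_eq_sum _ Q, pairing_sum_right h0 h0' (l := N + 1) Q.support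
    (fun d => Q.coeff d) (fun d => coulombDeriv (d 0) (d 1) (d 2) (axisPoint (-(R / 2))))
    (fun e he => by
      rw [← degree_eq_of_mem_support hQ he]
      exact isPole_coulombDeriv _ _ _ _) (isPole_coulombDeriv _ _ _ _) (by omega)]
  conv_rhs => rw [Finset.mul_sum, map_sum, Polynomial.finsetSum_coeff, Finset.mul_sum]
  rw [Finset.mul_sum]
  refine Finset.sum_congr rfl fun e he => ?_
  have he' := degree_eq_of_mem_support hQ he
  have hde : (d + e) 0 + (d + e) 1 + (d + e) 2 = M + N := by
    simp only [Finsupp.add_apply]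
    omega
  have key := pairing_coulombDeriv_coulomb hR ((d + e) 0) ((d + e) 1) ((d + e) 2)
  have hc := coeff_nullEval_monomial (d + e) (P.coeff d * Q.coeff e)
  rw [hde] at key hc
  rw [pairing_coulombDeriv_eq h0 h0', he', MvPolynomial.monomial_mul, hc]
  simp only [← Finsupp.add_apply]
  rw [key]
  ring

/-! ### Multipole fields as polynomial fields -/

/-- The polynomial of the elementary `2^M`-pole field of index `m`. -/
def basisPoly (M : ℕ) (m : ℤ) : MvPolynomial (Fin 3) ℂ :=
  if 0 < m then monomial (Finsupp.single 1 m.natAbs + Finsupp.single 2 (M - m.natAbs)) 1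
  else monomial (Finsupp.single 0 m.natAbs + Finsupp.single 2 (M - m.natAbs)) 1

/-- The polynomial of the `2^M`-pole field with components `A`. -/
def fieldPoly (M : ℕ) (A : ℤ → ℂ) : MvPolynomial (Fin 3) ℂ :=
  ∑ m ∈ Finset.Icc (-(M : ℤ)) (M : ℤ), A m • basisPoly M m

theorem polyField_basisPoly (M : ℕ) (m : ℤ) (X : Space) :
    polyField X (basisPoly M m) = basisField M m X := by
  unfold basisPoly basisField
  split_ifs <;> rw [polyField_monomial] <;> simp [coulombDeriv]

theorem polyField_fieldPoly (M : ℕ) (A : ℤ → ℂ) (X : Space) :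
    polyField X (fieldPoly M A) = field M A X := by
  funext x
  simp [fieldPoly, field, polyField_basisPoly, Finset.sum_apply]

theorem isHomogeneous_basisPoly {M : ℕ} {m : ℤ} (hm : m ∈ Finset.Icc (-(M : ℤ)) (M : ℤ)) :
    (basisPoly M m).IsHomogeneous M := by
  rw [Finset.mem_Icc] at hm
  unfold basisPoly
  split_ifs <;> refine MvPolynomial.isHomogeneous_monomial _ ?_ <;>
    simp only [map_add, Finsupp.degree_single] <;> omega

theorem isHomogeneous_fieldPoly (M : ℕ) (A : ℤ → ℂ) : (fieldPoly M A).IsHomogeneous M :=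
  MvPolynomial.IsHomogeneous.sum _ _ _ fun m hm => by
    rw [MvPolynomial.smul_eq_C_mul]
    simpa using (MvPolynomial.isHomogeneous_C _ (A m)).mul (isHomogeneous_basisPoly hm)

theorem nullEval_basisPoly {M : ℕ} {m : ℤ} (hm : m ∈ Finset.Icc (-(M : ℤ)) (M : ℤ)) :
    nullEval (basisPoly M m) =
      Polynomial.C ((Complex.I / 2) ^ m.natAbs) * Polynomial.X ^ (M + m).toNat := by
  rw [Finset.mem_Icc] at hm
  unfold basisPoly
  split_ifs <;> rw [nullEval_monomial] <;> simp <;> congr 1 <;> omega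

theorem nullEval_fieldPoly (M : ℕ) (A : ℤ → ℂ) :
    nullEval (fieldPoly M A) = ∑ m ∈ Finset.Icc (-(M : ℤ)) (M : ℤ),
      Polynomial.C (A m * (Complex.I / 2) ^ m.natAbs) * Polynomial.X ^ (M + m).toNat := by
  rw [fieldPoly, map_sum]
  refine Finset.sum_congr rfl fun m hm => ?_
  rw [map_smul, nullEval_basisPoly hm, Polynomial.smul_eq_C_mul, Polynomial.C_mul, mul_assoc]

/-- The interaction coefficient in terms of the components: only components of opposite indices
interact. -/
theorem coeff_nullEval_fieldPoly_mul (M N : ℕ) (A B : ℤ → ℂ) :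
    (nullEval (fieldPoly M A * fieldPoly N B)).coeff (M + N) =
      ∑ m ∈ Finset.Icc (-((min M N : ℕ) : ℤ)) ((min M N : ℕ) : ℤ),
        (-1 / 4) ^ m.natAbs * (A (-m) * B m) := by
  rw [map_mul, nullEval_fieldPoly, nullEval_fieldPoly, Finset.sum_mul_sum, Finset.sum_comm,
    Polynomial.finsetSum_coeff]
  have hI : (Complex.I / 2) ^ 2 = -1 / 4 := by
    rw [div_pow, Complex.I_sq]
    norm_num
  have key : ∀ n ∈ Finset.Icc (-(N : ℤ)) (N : ℤ), (∑ m ∈ Finset.Icc (-(M : ℤ)) (M : ℤ),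
      Polynomial.C (A m * (Complex.I / 2) ^ m.natAbs) * Polynomial.X ^ (M + m).toNat *
      (Polynomial.C (B n * (Complex.I / 2) ^ n.natAbs) * Polynomial.X ^ (N + n).toNat)).coeff
        (M + N) = if n ∈ Finset.Icc (-(M : ℤ)) (M : ℤ) then
          (-1 / 4) ^ n.natAbs * (A (-n) * B n) else 0 := by
    intro n hn
    rw [Finset.mem_Icc] at hn
    rw [Polynomial.finsetSum_coeff]
    have : ∀ m ∈ Finset.Icc (-(M : ℤ)) (M : ℤ),
        (Polynomial.C (A m * (Complex.I / 2) ^ m.natAbs) * Polynomial.X ^ (M + m).toNat *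
        (Polynomial.C (B n * (Complex.I / 2) ^ n.natAbs) *
          Polynomial.X ^ (N + n).toNat)).coeff (M + N) =
        if m = -n then (-1 / 4) ^ n.natAbs * (A (-n) * B n) else 0 := by
      intro m hm
      rw [Finset.mem_Icc] at hm
      rw [mul_mul_mul_comm, ← Polynomial.C_mul, ← pow_add, Polynomial.coeff_C_mul_X_pow]
      by_cases h : m = -n
      · rw [if_pos (by omega), if_pos h, h, Int.natAbs_neg, ← hI, ← pow_mul]
        ring1
      · rw [if_neg (by omega), if_neg h]
    rw [Finset.sum_congr rfl this, Finset.sum_ite_eq']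
    refine if_congr ?_ rfl rfl
    simp only [Finset.mem_Icc]
    omega
  rw [Finset.sum_congr rfl key, ← Finset.sum_filter]
  refine Finset.sum_congr ?_ fun _ _ => rfl
  ext n
  simp only [Finset.mem_filter, Finset.mem_Icc]
  omega

/-! ### Rotations -/

section Rotation

variable {X x : Space}

theorem polyField_X_zero_mul (X : Space) (P : MvPolynomial (Fin 3) ℂ) :
    Set.EqOn (polyField X (MvPolynomial.X 0 * P)) (dz (polyField X P)) {X}ᶜ := by
  induction P using MvPolynomial.induction_on' with
  | monomial d c =>
    intro x hx
    have h := isPole_coulombDeriv (d 0) (d 1) (d 2) X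
    rw [MvPolynomial.X, MvPolynomial.monomial_mul, polyField_monomial, polyField_monomial, dz,
      pderiv_const_mul h.smooth hx, pderiv_const_mul h.smooth hx, one_mul]
    have := dz_coulombDeriv (d 0) (d 1) (d 2) X hx
    rw [dz] at this
    simp [add_comm 1, ← this]
    ring
  | add P Q hP hQ =>
    intro x hx
    have sP := smooth_polyField P X
    have sQ := smooth_polyField Q X
    have e : polyField X (P + Q) = fun x => polyField X P x + polyField X Q x := by
      rw [map_add]
      rfl
    rw [mul_add, map_add, Pi.add_apply, hP hx, hQ hx, e, dz, dz, dz, pderiv_add sP sQ hx,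
      pderiv_add sP sQ hx]
    ring

theorem polyField_X_one_mul (X : Space) (P : MvPolynomial (Fin 3) ℂ) :
    Set.EqOn (polyField X (MvPolynomial.X 1 * P)) (dzbar (polyField X P)) {X}ᶜ := by
  induction P using MvPolynomial.induction_on' with
  | monomial d c =>
    intro x hx
    have h := isPole_coulombDeriv (d 0) (d 1) (d 2) X
    rw [MvPolynomial.X, MvPolynomial.monomial_mul, polyField_monomial, polyField_monomial, dzbar,
      pderiv_const_mul h.smooth hx, pderiv_const_mul h.smooth hx, one_mul]
    have := dzbar_coulombDeriv (d 0) (d 1) (d 2) X hx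
    rw [dzbar] at this
    simp [add_comm 1, ← this]
    ring
  | add P Q hP hQ =>
    intro x hx
    have sP := smooth_polyField P X
    have sQ := smooth_polyField Q X
    have e : polyField X (P + Q) = fun x => polyField X P x + polyField X Q x := by
      rw [map_add]
      rfl
    rw [mul_add, map_add, Pi.add_apply, hP hx, hQ hx, e, dzbar, dzbar, dzbar,
      pderiv_add sP sQ hx, pderiv_add sP sQ hx]
    ring

theorem polyField_X_two_mul (X : Space) (P : MvPolynomial (Fin 3) ℂ) :
    Set.EqOn (polyField X (MvPolynomial.X 2 * P)) (pderiv 2 (polyField X P)) {X}ᶜ := by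
  induction P using MvPolynomial.induction_on' with
  | monomial d c =>
    intro x hx
    have h := isPole_coulombDeriv (d 0) (d 1) (d 2) X
    rw [MvPolynomial.X, MvPolynomial.monomial_mul, polyField_monomial, polyField_monomial,
      pderiv_const_mul h.smooth hx, one_mul, ← coulombDeriv_succ_two]
    simp [add_comm 1]
  | add P Q hP hQ =>
    intro x hx
    have e : polyField X (P + Q) = fun x => polyField X P x + polyField X Q x := by
      rw [map_add]
      rfl
    rw [mul_add, map_add, Pi.add_apply, hP hx, hQ hx, e,
      pderiv_add (smooth_polyField P X) (smooth_polyField Q X) hx]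

/-- The polynomials that stand for the derivatives `∂₁, ∂₂, ∂₃`. -/
def cart : Fin 3 → MvPolynomial (Fin 3) ℂ :=
  ![MvPolynomial.X 0 + MvPolynomial.X 1,
    Complex.I • (MvPolynomial.X 0 - MvPolynomial.X 1), MvPolynomial.X 2]

theorem X_zero_eq_cart : (MvPolynomial.X 0 : MvPolynomial (Fin 3) ℂ) =
    (1 / 2 : ℂ) • cart 0 + (-Complex.I / 2) • cart 1 := by
  simp only [cart, Matrix.cons_val_zero, Matrix.cons_val_one, smul_smul]
  rw [div_mul_eq_mul_div, neg_mul, Complex.I_mul_I]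
  module

theorem X_one_eq_cart : (MvPolynomial.X 1 : MvPolynomial (Fin 3) ℂ) =
    (1 / 2 : ℂ) • cart 0 + (Complex.I / 2) • cart 1 := by
  simp only [cart, Matrix.cons_val_zero, Matrix.cons_val_one, smul_smul]
  rw [div_mul_eq_mul_div, Complex.I_mul_I]
  module

theorem polyField_cart_mul (hx : x ≠ X) (j : Fin 3) (P : MvPolynomial (Fin 3) ℂ) :
    polyField X (cart j * P) x = pderiv j (polyField X P) x := by
  have h0 := polyField_X_zero_mul X P hx
  have h1 := polyField_X_one_mul X P hx
  have h2 := polyField_X_two_mul X P hx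
  rw [dz] at h0
  rw [dzbar] at h1
  fin_cases j
  · simp only [cart, Fin.zero_eta, Matrix.cons_val_zero]
    rw [add_mul, map_add, Pi.add_apply, h0, h1]
    ring
  · simp only [cart, Fin.mk_one, Matrix.cons_val_one, Matrix.cons_val_zero]
    rw [smul_mul_assoc, sub_mul, map_smul, map_sub, Pi.smul_apply,
      Pi.sub_apply, h0, h1, smul_eq_mul]
    linear_combination -(pderiv 1 (polyField X P) x) * Complex.I_sq
  · exact h2

/-- The polynomials that stand for the rotated derivatives `∑ₖ Tⱼₖ ∂ₖ`. -/
def rotCart (T : Matrix (Fin 3) (Fin 3) ℝ) (j : Fin 3) : MvPolynomial (Fin 3) ℂ :=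
  ∑ k, (T j k : ℂ) • cart k

/-- The images of `∂, ∂̄, ∂₃` when `∂ⱼ` is replaced by `∑ₖ Tⱼₖ ∂ₖ`. -/
def rotGen (T : Matrix (Fin 3) (Fin 3) ℝ) : Fin 3 → MvPolynomial (Fin 3) ℂ :=
  ![(1 / 2 : ℂ) • rotCart T 0 + (-Complex.I / 2) • rotCart T 1,
    (1 / 2 : ℂ) • rotCart T 0 + (Complex.I / 2) • rotCart T 1, rotCart T 2]

/-- The linear substitution by which a rotation of space acts on polynomials in the
derivatives. -/
def rotPoly (T : Matrix (Fin 3) (Fin 3) ℝ) :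
    MvPolynomial (Fin 3) ℂ →ₐ[ℂ] MvPolynomial (Fin 3) ℂ :=
  MvPolynomial.aeval (rotGen T)

theorem rotPoly_X (T : Matrix (Fin 3) (Fin 3) ℝ) (i : Fin 3) :
    rotPoly T (MvPolynomial.X i) = rotGen T i := by
  rw [rotPoly, MvPolynomial.aeval_X]

theorem rotPoly_cart (T : Matrix (Fin 3) (Fin 3) ℝ) (j : Fin 3) :
    rotPoly T (cart j) = rotCart T j := by
  fin_cases j
  · simp only [cart, Fin.zero_eta, Matrix.cons_val_zero, map_add, rotPoly_X, rotGen,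
      Matrix.cons_val_one]
    module
  · simp only [cart, Fin.mk_one, Matrix.cons_val_one, Matrix.cons_val_zero, map_sub, map_smul,
      rotPoly_X, rotGen]
    rw [add_sub_add_left_eq_sub, ← sub_smul, smul_smul,
      show Complex.I * (-Complex.I / 2 - Complex.I / 2) = -(Complex.I * Complex.I) by ring,
      Complex.I_mul_I, neg_neg, one_smul]
  · simp [cart, rotPoly_X, rotGen]

theorem rotCart_one : rotCart 1 = cart := by
  funext j
  simp [rotCart, Matrix.one_apply, apply_ite Complex.ofReal]

/-- Two algebra homomorphisms that agree on the cartesian derivatives are equal. -/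
theorem algHom_ext_cart {S : Type*} [CommRing S] [Algebra ℂ S]
    {φ ψ : MvPolynomial (Fin 3) ℂ →ₐ[ℂ] S} (h : ∀ j, φ (cart j) = ψ (cart j)) : φ = ψ := by
  refine MvPolynomial.algHom_ext fun i => ?_
  fin_cases i
  · simp only [Fin.zero_eta]
    rw [X_zero_eq_cart]
    simp only [map_add, map_smul, h]
  · simp only [Fin.mk_one]
    rw [X_one_eq_cart]
    simp only [map_add, map_smul, h]
  · exact h 2

theorem rotPoly_one : rotPoly 1 = AlgHom.id ℂ _ :=
  algHom_ext_cart fun j => by rw [rotPoly_cart, rotCart_one, AlgHom.id_apply]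

theorem rotPoly_mul (S T : Matrix (Fin 3) (Fin 3) ℝ) :
    rotPoly (S * T) = (rotPoly T).comp (rotPoly S) :=
  algHom_ext_cart fun j => by
    rw [AlgHom.comp_apply, rotPoly_cart, rotPoly_cart]
    simp only [rotCart, map_sum, map_smul, rotPoly_cart, Matrix.mul_apply, Complex.ofReal_sum,
      Complex.ofReal_mul, Finset.smul_sum, Finset.sum_smul, smul_smul]
    exact Finset.sum_comm

theorem isHomogeneous_smul (c : ℂ) {P : MvPolynomial (Fin 3) ℂ} {M : ℕ}
    (hP : P.IsHomogeneous M) : (c • P).IsHomogeneous M := by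
  rw [MvPolynomial.smul_eq_C_mul]
  simpa using (MvPolynomial.isHomogeneous_C (Fin 3) c).mul hP

theorem isHomogeneous_cart (j : Fin 3) : (cart j).IsHomogeneous 1 := by
  have h := fun i : Fin 3 => MvPolynomial.isHomogeneous_X ℂ i
  fin_cases j
  · exact (h 0).add (h 1)
  · exact isHomogeneous_smul _ ((h 0).sub (h 1))
  · exact h 2

theorem isHomogeneous_rotPoly (T : Matrix (Fin 3) (Fin 3) ℝ) {P : MvPolynomial (Fin 3) ℂ} {M : ℕ}
    (hP : P.IsHomogeneous M) : (rotPoly T P).IsHomogeneous M := by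
  have hr : ∀ j, (rotCart T j).IsHomogeneous 1 := fun j =>
    MvPolynomial.IsHomogeneous.sum _ _ _ fun k _ => isHomogeneous_smul _ (isHomogeneous_cart k)
  have := hP.aeval (n := 1) (rotGen T) fun i => by
    fin_cases i
    · exact (isHomogeneous_smul _ (hr 0)).add (isHomogeneous_smul _ (hr 1))
    · exact (isHomogeneous_smul _ (hr 0)).add (isHomogeneous_smul _ (hr 1))
    · exact hr 2
  rwa [one_mul] at this

theorem norm_toEuclideanLin {T : Matrix (Fin 3) (Fin 3) ℝ} (hT : T.transpose * T = 1)
    (y : Space) : ‖Matrix.toEuclideanLin T y‖ = ‖y‖ := by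
  rw [← sq_eq_sq₀ (norm_nonneg _) (norm_nonneg _), ← real_inner_self_eq_norm_sq,
    ← real_inner_self_eq_norm_sq]
  have h : ∀ z : Space, inner ℝ z z = dotProduct (WithLp.ofLp z) (WithLp.ofLp z) := fun z => by
    simp only [PiLp.inner_apply, dotProduct]
    rfl
  rw [h, h]
  have e : WithLp.ofLp (Matrix.toEuclideanLin T y) = T.mulVec (WithLp.ofLp y) := rfl
  rw [e, Matrix.dotProduct_mulVec, ← Matrix.mulVec_transpose, Matrix.mulVec_mulVec, hT,
    Matrix.one_mulVec]

/-- The chain rule for an orthogonal map `T` about the point `X`. -/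
theorem pderiv_comp_rot {T : Matrix (Fin 3) (Fin 3) ℝ} (hT : T * T.transpose = 1)
    {f : Space → ℂ} (hf : DifferentiableAt ℝ f (X + Matrix.toEuclideanLin T (x - X)))
    (j : Fin 3) :
    pderiv j f (X + Matrix.toEuclideanLin T (x - X)) =
      ∑ k, (T j k : ℂ) * pderiv k (fun y => f (X + Matrix.toEuclideanLin T (y - X))) x := by
  set L : Space →L[ℝ] Space := LinearMap.toContinuousLinearMap (Matrix.toEuclideanLin T)
  have hρ : HasFDerivAt (fun y : Space => X + Matrix.toEuclideanLin T (y - X)) L x := by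
    have := (L.hasFDerivAt (x := x - X)).comp x ((hasFDerivAt_id x).sub_const X)
    exact this.const_add X
  have key : ∀ k, pderiv k (fun y => f (X + Matrix.toEuclideanLin T (y - X))) x =
      ∑ i, (T i k : ℂ) * pderiv i f (X + Matrix.toEuclideanLin T (x - X)) := by
    intro k
    have h := (HasFDerivAt.comp x hf.hasFDerivAt hρ).fderiv
    have h2 : pderiv k (fun y => f (X + Matrix.toEuclideanLin T (y - X))) x =
        fderiv ℝ f (X + Matrix.toEuclideanLin T (x - X)) (L (EuclideanSpace.single k 1)) := by
      unfold pderiv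
      exact congrArg (fun F : Space →L[ℝ] ℂ => F (EuclideanSpace.single k 1)) h
    rw [h2, fderiv_apply_eq_sum]
    refine Finset.sum_congr rfl fun i _ => ?_
    congr 2
    simp [L, Matrix.toLpLin_apply]
  simp only [key, Finset.mul_sum]
  rw [Finset.sum_comm]
  have horth : ∀ i, ∑ k, (T j k : ℂ) * T i k = if j = i then 1 else 0 := fun i => by
    have := congrFun (congrFun hT j) i
    rw [Matrix.mul_apply, Matrix.one_apply] at this
    simp only [Matrix.transpose_apply] at this
    rw [← Complex.ofReal_one, ← Complex.ofReal_zero, ← apply_ite Complex.ofReal, ← this]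
    push_cast
    rfl
  simp only [← mul_assoc, ← Finset.sum_mul, horth]
  simp

/-- Rotating a polynomial field about its centre amounts to a linear substitution in the
polynomial. -/
theorem polyField_comp_rot {T : Matrix (Fin 3) (Fin 3) ℝ}
    (hT : T ∈ Matrix.orthogonalGroup (Fin 3) ℝ)
    (P : MvPolynomial (Fin 3) ℂ) :
    Set.EqOn (fun x => polyField X P (X + Matrix.toEuclideanLin T (x - X)))
      (polyField X (rotPoly T P)) {X}ᶜ := by
  have hT1 : T * T.transpose = 1 := (Matrix.mem_orthogonalGroup_iff _ _).mp hT
  have hT2 : T.transpose * T = 1 := (Matrix.mem_orthogonalGroup_iff' _ _).mp hT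
  induction P using MvPolynomial.induction_on with
  | C a =>
    intro x hx
    have e : ∀ Y : Space, polyField Y (MvPolynomial.C a) = fun x => a * coulomb Y x := fun Y =>
      polyField_monomial Y 0 a
    rw [MvPolynomial.algHom_C, MvPolynomial.algebraMap_eq, e]
    simp only [coulomb, add_sub_cancel_left, norm_toEuclideanLin hT2]
  | add P Q hP hQ =>
    intro x hx
    have h1 := hP hx
    have h2 := hQ hx
    simp only [map_add, Pi.add_apply] at h1 h2 ⊢
    rw [h1, h2]
  | mul_X P i hP =>
    intro x hx
    have hx' : X + Matrix.toEuclideanLin T (x - X) ≠ X := by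
      rw [Ne, add_eq_left, ← norm_eq_zero, norm_toEuclideanLin hT2, norm_eq_zero, sub_eq_zero]
      exact hx
    -- a cartesian derivative of the rotated field
    have key : ∀ j, polyField X (cart j * P) (X + Matrix.toEuclideanLin T (x - X)) =
        polyField X (rotPoly T (cart j * P)) x := fun j => by
      rw [polyField_cart_mul hx', pderiv_comp_rot hT1
        (differentiableAt_of_smooth (smooth_polyField P X) hx'), map_mul, rotPoly_cart, rotCart,
        Finset.sum_mul, map_sum, Finset.sum_apply]
      refine Finset.sum_congr rfl fun k _ => ?_
      rw [pderiv_congr hP k hx, ← polyField_cart_mul hx, smul_mul_assoc, map_smul]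
      rfl
    have hlin : ∀ a b : ℂ, polyField X (a • (cart 0 * P) + b • (cart 1 * P))
        (X + Matrix.toEuclideanLin T (x - X)) =
        polyField X (rotPoly T (a • (cart 0 * P) + b • (cart 1 * P))) x := fun a b => by
      simp only [map_add, map_smul, Pi.add_apply, Pi.smul_apply, key]
    fin_cases i
    · simp only [Fin.zero_eta]
      rw [mul_comm, X_zero_eq_cart, add_mul, smul_mul_assoc, smul_mul_assoc]
      exact hlin _ _
    · simp only [Fin.mk_one]
      rw [mul_comm, X_one_eq_cart, add_mul, smul_mul_assoc, smul_mul_assoc]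
      exact hlin _ _
    · rw [mul_comm]
      exact key 2

end Rotation

/-! ### Rotations about the `x₃`-axis and the `x₁`-axis -/

/-- The rotation about the `x₃`-axis by the argument of `u`, for `|u| = 1`. -/
def rotThree (u : ℂ) : Matrix (Fin 3) (Fin 3) ℝ :=
  !![u.re, -u.im, 0; u.im, u.re, 0; 0, 0, 1]

/-- The rotation about the `x₁`-axis by the angle `2 arctan t`. -/
def rotOne (t : ℝ) : Matrix (Fin 3) (Fin 3) ℝ :=
  !![1, 0, 0;
    0, (1 - t ^ 2) / (1 + t ^ 2), -(2 * t / (1 + t ^ 2));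
    0, 2 * t / (1 + t ^ 2), (1 - t ^ 2) / (1 + t ^ 2)]

theorem rotThree_mem {u : ℂ} (hu : u.re ^ 2 + u.im ^ 2 = 1) :
    rotThree u ∈ Matrix.specialOrthogonalGroup (Fin 3) ℝ := by
  rw [Matrix.mem_specialOrthogonalGroup_iff, Matrix.mem_orthogonalGroup_iff]
  constructor
  · ext i j
    fin_cases i <;> fin_cases j <;>
      simp [rotThree, Matrix.mul_apply, Fin.sum_univ_three] <;>
      linarith
  · rw [Matrix.det_fin_three]
    simp [rotThree]
    linarith

theorem rotOne_mem (t : ℝ) : rotOne t ∈ Matrix.specialOrthogonalGroup (Fin 3) ℝ := by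
  have h : 1 + t ^ 2 ≠ 0 := by positivity
  rw [Matrix.mem_specialOrthogonalGroup_iff, Matrix.mem_orthogonalGroup_iff]
  constructor
  · ext i j
    fin_cases i <;> fin_cases j <;>
      simp [rotOne, Matrix.mul_apply, Fin.sum_univ_three] <;>
      field_simp <;> ring
  · rw [Matrix.det_fin_three]
    simp [rotOne]
    field_simp
    ring

theorem basisPoly_eq (M : ℕ) (m : ℤ) : basisPoly M m =
    if 0 < m then MvPolynomial.X 1 ^ m.natAbs * MvPolynomial.X 2 ^ (M - m.natAbs)
    else MvPolynomial.X 0 ^ m.natAbs * MvPolynomial.X 2 ^ (M - m.natAbs) := by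
  simp only [basisPoly, MvPolynomial.X_pow_eq_monomial, MvPolynomial.monomial_mul, one_mul]

section AxisRotation

variable {u : ℂ}

theorem re_sub_im_mul_I_mul_self (hu : u.re ^ 2 + u.im ^ 2 = 1) :
    u * (u.re - u.im * Complex.I) = 1 := by
  have hu' : (u.re : ℂ) ^ 2 + (u.im : ℂ) ^ 2 = 1 := by exact_mod_cast hu
  nth_rewrite 1 [← Complex.re_add_im u]
  linear_combination hu' - (u.im : ℂ) ^ 2 * Complex.I_sq

theorem rotPoly_rotThree_X_zero (hu : u.re ^ 2 + u.im ^ 2 = 1) :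
    rotPoly (rotThree u) (MvPolynomial.X 0) = u⁻¹ • MvPolynomial.X 0 := by
  rw [inv_eq_of_mul_eq_one_right (re_sub_im_mul_I_mul_self hu), rotPoly_X, X_zero_eq_cart]
  simp [rotGen, rotCart, rotThree, Fin.sum_univ_three, smul_smul, ← sub_eq_add_neg,
    -Complex.coe_smul]
  match_scalars
  · ring
  · linear_combination (-1 / 2) * (u.im : ℂ) * Complex.I_sq

theorem rotPoly_rotThree_X_one :
    rotPoly (rotThree u) (MvPolynomial.X 1) = u • MvPolynomial.X 1 := by
  conv_rhs => rw [← Complex.re_add_im u]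
  rw [rotPoly_X, X_one_eq_cart]
  simp [rotGen, rotCart, rotThree, Fin.sum_univ_three, smul_smul, ← sub_eq_add_neg,
    -Complex.coe_smul, -Complex.re_add_im]
  match_scalars
  · ring
  · linear_combination (-1 / 2) * (u.im : ℂ) * Complex.I_sq

theorem rotPoly_rotThree_X_two :
    rotPoly (rotThree u) (MvPolynomial.X 2) = MvPolynomial.X 2 := by
  simp [rotPoly_X, rotGen, rotCart, rotThree, Fin.sum_univ_three, cart]

theorem rotPoly_rotThree_basisPoly (hu : u.re ^ 2 + u.im ^ 2 = 1) (M : ℕ) (m : ℤ) :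
    rotPoly (rotThree u) (basisPoly M m) = u ^ m • basisPoly M m := by
  rw [basisPoly_eq]
  split_ifs with hm
  · obtain ⟨k, rfl⟩ : ∃ k : ℕ, m = k := ⟨m.natAbs, by omega⟩
    rw [map_mul, map_pow, map_pow, rotPoly_rotThree_X_one, rotPoly_rotThree_X_two, smul_pow,
      smul_mul_assoc, zpow_natCast, Int.natAbs_natCast]
  · obtain ⟨k, rfl⟩ : ∃ k : ℕ, m = -k := ⟨m.natAbs, by omega⟩
    rw [map_mul, map_pow, map_pow, rotPoly_rotThree_X_zero hu, rotPoly_rotThree_X_two, smul_pow,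
      smul_mul_assoc, zpow_neg, zpow_natCast, Int.natAbs_neg, Int.natAbs_natCast, inv_pow]

/-- A rotation about the axis multiplies the component of index `m` by a character. -/
theorem rotPoly_rotThree_fieldPoly (hu : u.re ^ 2 + u.im ^ 2 = 1) (M : ℕ) (A : ℤ → ℂ) :
    rotPoly (rotThree u) (fieldPoly M A) = fieldPoly M fun m => u ^ m * A m := by
  simp only [fieldPoly, map_sum, map_smul, rotPoly_rotThree_basisPoly hu, smul_smul, mul_comm]

/-- The interaction coefficient is invariant under rotations of both fields about the axis. -/
theorem coeff_nullEval_rotThree (hu : u.re ^ 2 + u.im ^ 2 = 1) {K : ℕ}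
    {P : MvPolynomial (Fin 3) ℂ} (hP : P.IsHomogeneous K) :
    (nullEval (rotPoly (rotThree u) P)).coeff K = (nullEval P).coeff K := by
  have h0 : u ≠ 0 := left_ne_zero_of_mul_eq_one (re_sub_im_mul_I_mul_self hu)
  conv_lhs => rw [P.as_sum]
  conv_rhs => rw [P.as_sum]
  simp only [map_sum, Polynomial.finsetSum_coeff]
  refine Finset.sum_congr rfl fun d hd => ?_
  have e : rotPoly (rotThree u) (monomial d (P.coeff d)) =
      monomial d (u⁻¹ ^ d 0 * u ^ d 1 * P.coeff d) := by
    rw [MvPolynomial.monomial_eq, MvPolynomial.monomial_eq, Finsupp.prod_fintype _ _ (by simp),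
      Fin.prod_univ_three]
    simp only [map_mul, map_pow, MvPolynomial.algHom_C, MvPolynomial.algebraMap_eq,
      rotPoly_rotThree_X_zero hu, rotPoly_rotThree_X_one, rotPoly_rotThree_X_two,
      MvPolynomial.smul_eq_C_mul]
    ring
  rw [e, ← degree_eq_of_mem_support hP hd, coeff_nullEval_monomial, coeff_nullEval_monomial]
  by_cases h : d 0 = d 1
  · rw [h, ← mul_pow, inv_mul_cancel₀ h0, one_pow, one_mul]
  · simp [h]

end AxisRotation

open Polynomial in
/-- On the null vectors a rotation about the `x₁`-axis acts by a Möbius transformation. -/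
theorem nullEval_rotOne (t : ℝ) (i : Fin 3) :
    (C (1 + (t : ℂ) ^ 2) : ℂ[X]) * nullEval (rotPoly (rotOne t) (MvPolynomial.X i)) =
      ![C (Complex.I / 2) * (C (t : ℂ) * X + 1) ^ 2, C (Complex.I / 2) * (X - C (t : ℂ)) ^ 2,
        (X - C (t : ℂ)) * (C (t : ℂ) * X + 1)] i := by
  have ht : (1 + (t : ℂ) ^ 2) ≠ 0 := by
    have : (1 + t ^ 2 : ℝ) ≠ 0 := by positivity
    exact_mod_cast this
  have c0 : nullEval (cart 0) = C (Complex.I / 2) * (1 + X ^ 2) := by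
    simp [cart, nullEval]
    ring
  have c1 : nullEval (cart 1) = C (1 / 2) * (X ^ 2 - 1) := by
    have : C (Complex.I) * C (Complex.I / 2) = (C (-1 / 2) : ℂ[X]) := by
      rw [← C_mul]
      congr 1
      linear_combination (1 / 2) * Complex.I_sq
    simp only [cart, nullEval, Matrix.cons_val_one, Matrix.cons_val_zero, map_smul, map_sub,
      MvPolynomial.aeval_X, smul_eq_C_mul]
    rw [mul_sub, ← mul_assoc, this, neg_div, C_neg]
    ring
  have c2 : nullEval (cart 2) = X := by simp [cart, nullEval]
  -- the entries of the matrix after clearing the denominator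
  set s : ℂ := 2 * t / (1 + t ^ 2) with hs
  set c : ℂ := (1 - t ^ 2) / (1 + t ^ 2) with hc
  have hs' : (C (1 + (t : ℂ) ^ 2) : ℂ[X]) * C s = 2 * C (t : ℂ) := by
    rw [← C_mul, hs, mul_div_cancel₀ _ ht, C_mul]
    rfl
  have hc' : (C (1 + (t : ℂ) ^ 2) : ℂ[X]) * C c = 1 - C (t : ℂ) ^ 2 := by
    rw [← C_mul, hc, mul_div_cancel₀ _ ht]
    simp
  have h1 : (C (1 + (t : ℂ) ^ 2) : ℂ[X]) = 1 + C (t : ℂ) ^ 2 := by simp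
  have r0 : rotCart (rotOne t) 0 = cart 0 := by
    simp [rotCart, rotOne, Fin.sum_univ_three]
  have r1 : rotCart (rotOne t) 1 = c • cart 1 - s • cart 2 := by
    simp [-Complex.coe_smul, rotCart, rotOne, Fin.sum_univ_three, hc, hs, sub_eq_add_neg]
  have r2 : rotCart (rotOne t) 2 = s • cart 1 + c • cart 2 := by
    simp [-Complex.coe_smul, rotCart, rotOne, Fin.sum_univ_three, hc, hs]
  have n0 : nullEval (rotCart (rotOne t) 0) = C (Complex.I / 2) * (1 + X ^ 2) := by rw [r0, c0]
  have n1 : (C (1 + (t : ℂ) ^ 2) : ℂ[X]) * nullEval (rotCart (rotOne t) 1) =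
      C (1 / 2) * ((1 - C (t : ℂ) ^ 2) * (X ^ 2 - 1)) - 2 * C (t : ℂ) * X := by
    rw [r1, map_sub, map_smul, map_smul, c1, c2, smul_eq_C_mul, smul_eq_C_mul]
    linear_combination C (1 / 2) * (X ^ 2 - 1) * hc' - X * hs'
  have n2 : (C (1 + (t : ℂ) ^ 2) : ℂ[X]) * nullEval (rotCart (rotOne t) 2) =
      C (1 / 2) * (2 * C (t : ℂ) * (X ^ 2 - 1)) + (1 - C (t : ℂ) ^ 2) * X := by
    rw [r2, map_add nullEval, map_smul, map_smul, c1, c2, smul_eq_C_mul, smul_eq_C_mul]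
    linear_combination C (1 / 2) * (X ^ 2 - 1) * hs' + X * hc'
  have hh : (C (1 / 2) : ℂ[X]) * 2 = 1 := by
    rw [show (2 : ℂ[X]) = C 2 from rfl, ← C_mul]
    norm_num
  have hI : (C (Complex.I / 2) : ℂ[X]) = C Complex.I * C (1 / 2) := by
    rw [← C_mul]
    congr 1
    ring
  have hI' : (C (-Complex.I / 2) : ℂ[X]) = -(C Complex.I * C (1 / 2)) := by
    rw [← C_mul, ← C_neg]
    congr 1
    ring
  rw [hI] at n0
  rw [h1] at n1 n2 ⊢
  rw [rotPoly_X]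
  fin_cases i
  · simp only [rotGen, Fin.zero_eta, Matrix.cons_val_zero, map_add, map_smul, smul_eq_C_mul]
    rw [hI, hI', n0]
    linear_combination -(C Complex.I * C (1 / 2)) * n1 +
      C Complex.I * C (1 / 2) * (C (t : ℂ) ^ 2 * X ^ 2 + 1) * hh
  · simp only [rotGen, Fin.mk_one, Matrix.cons_val_one, Matrix.cons_val_zero, map_add, map_smul,
      smul_eq_C_mul]
    rw [hI, n0]
    linear_combination (C Complex.I * C (1 / 2)) * n1 +
      C Complex.I * C (1 / 2) * (C (t : ℂ) ^ 2 + X ^ 2) * hh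
  · change (1 + C (t : ℂ) ^ 2) * nullEval (rotCart (rotOne t) 2) =
      (X - C (t : ℂ)) * (C (t : ℂ) * X + 1)
    linear_combination n2 + C (t : ℂ) * (X ^ 2 - 1) * hh

/-! ### A rotation that makes the interaction non-zero -/

section Existence

open Polynomial

/-- A non-zero trigonometric polynomial does not vanish on the whole unit circle. -/
theorem exists_unit_sum_ne_zero (M : ℕ) (a : ℤ → ℂ)
    (ha : ∃ m ∈ Finset.Icc (-(M : ℤ)) (M : ℤ), a m ≠ 0) :
    ∃ u : ℂ, u.re ^ 2 + u.im ^ 2 = 1 ∧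
      ∑ m ∈ Finset.Icc (-(M : ℤ)) (M : ℤ), u ^ m * a m ≠ 0 := by
  obtain ⟨m₀, hm₀, ha₀⟩ := ha
  set p : ℂ[X] := ∑ m ∈ Finset.Icc (-(M : ℤ)) (M : ℤ), C (a m) * X ^ (M + m).toNat with hp
  have hp0 : p ≠ 0 := by
    intro h
    have hc : p.coeff (M + m₀).toNat = a m₀ := by
      rw [hp, finsetSum_coeff, Finset.sum_eq_single m₀]
      · simp
      · intro m hm hne
        rw [Finset.mem_Icc] at hm hm₀
        rw [coeff_C_mul_X_pow, if_neg (by omega)]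
      · exact fun h => absurd hm₀ h
    rw [h, coeff_zero] at hc
    exact ha₀ hc.symm
  have hinf : (Metric.sphere (0 : ℂ) 1).Infinite := by
    have hrank : 1 < Module.rank ℝ ℂ := by
      rw [Complex.rank_real_complex]
      exact_mod_cast one_lt_two
    refine (isPreconnected_sphere hrank 0 1).infinite_of_nontrivial ⟨1, by simp, -1, by simp, ?_⟩
    norm_num
  obtain ⟨u, hu, hu0⟩ : ∃ u ∈ Metric.sphere (0 : ℂ) 1, ¬p.IsRoot u := by
    by_contra! h
    exact hp0 (eq_zero_of_infinite_isRoot p (hinf.mono h))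
  have hu1 : ‖u‖ = 1 := by simpa using hu
  have hne : u ≠ 0 := norm_ne_zero_iff.mp (by rw [hu1]; exact one_ne_zero)
  refine ⟨u, ?_, fun h => hu0 ?_⟩
  · have := Complex.sq_norm u
    rw [hu1, Complex.normSq_apply] at this
    linarith
  · have e : p.eval u = u ^ (M : ℤ) * ∑ m ∈ Finset.Icc (-(M : ℤ)) (M : ℤ), u ^ m * a m := by
      rw [hp, eval_finsetSum, Finset.mul_sum]
      refine Finset.sum_congr rfl fun m hm => ?_
      rw [Finset.mem_Icc] at hm
      rw [eval_mul, eval_C, eval_pow, eval_X, ← zpow_natCast, Int.toNat_of_nonneg (by omega),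
        zpow_add₀ hne]
      ring
    rw [IsRoot, e, h, mul_zero]

theorem C_pow_mul_nullEval_rotOne_basisPoly (t : ℝ) {N : ℕ} {n : ℤ}
    (hn : n ∈ Finset.Icc (-(N : ℤ)) (N : ℤ)) :
    (C (1 + (t : ℂ) ^ 2) : ℂ[X]) ^ N * nullEval (rotPoly (rotOne t) (basisPoly N n)) =
      C ((Complex.I / 2) ^ n.natAbs) * ((X - C (t : ℂ)) ^ (N + n).toNat *
        (C (t : ℂ) * X + 1) ^ (N - n).toNat) := by
  rw [Finset.mem_Icc] at hn
  have h0 := nullEval_rotOne t 0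
  have h1 := nullEval_rotOne t 1
  have h2 := nullEval_rotOne t 2
  simp only [Matrix.cons_val_zero, Matrix.cons_val_one] at h0 h1
  change _ = (X - C (t : ℂ)) * (C (t : ℂ) * X + 1) at h2
  have hN : (C (1 + (t : ℂ) ^ 2) : ℂ[X]) ^ N =
      C (1 + (t : ℂ) ^ 2) ^ n.natAbs * C (1 + (t : ℂ) ^ 2) ^ (N - n.natAbs) := by
    rw [← pow_add]
    congr 1
    omega
  rw [hN, basisPoly_eq]
  split_ifs with hpos
  · rw [map_mul, map_pow, map_pow, map_mul, map_pow, map_pow, mul_mul_mul_comm, ← mul_pow,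
      ← mul_pow, h1, h2, show (N + n).toNat = n.natAbs + n.natAbs + (N - n.natAbs) by omega,
      show (N - n).toNat = N - n.natAbs by omega, C_pow]
    generalize X - C (t : ℂ) = a
    generalize C (t : ℂ) * X + 1 = b
    ring
  · rw [map_mul, map_pow, map_pow, map_mul, map_pow, map_pow, mul_mul_mul_comm, ← mul_pow,
      ← mul_pow, h0, h2, show (N - n).toNat = n.natAbs + n.natAbs + (N - n.natAbs) by omega,
      show (N + n).toNat = N - n.natAbs by omega, C_pow]
    generalize X - C (t : ℂ) = a
    generalize C (t : ℂ) * X + 1 = b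
    ring

/-- The interaction coefficient of `A` with `B` rotated about the `x₁`-axis by `2 arctan t`, up to
the factor `(1 + t²)^N`, as a polynomial in `t`. -/
def tiltPoly (M N : ℕ) (A B : ℤ → ℂ) : ℂ[X] :=
  ∑ n ∈ Finset.Icc (-(N : ℤ)) (N : ℤ), C (B n * (Complex.I / 2) ^ n.natAbs) *
    ((nullEval (fieldPoly M A)).map C * ((X - C X) ^ (N + n).toNat *
      (C X * X + 1) ^ (N - n).toNat) : ℂ[X][X]).coeff (M + N)

theorem eval_tiltPoly (M N : ℕ) (A B : ℤ → ℂ) (t : ℂ) :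
    (tiltPoly M N A B).eval t =
      ∑ n ∈ Finset.Icc (-(N : ℤ)) (N : ℤ), B n * (Complex.I / 2) ^ n.natAbs *
        (nullEval (fieldPoly M A) * ((X - C t) ^ (N + n).toNat *
          (C t * X + 1) ^ (N - n).toNat)).coeff (M + N) := by
  rw [tiltPoly, eval_finsetSum]
  refine Finset.sum_congr rfl fun n _ => ?_
  rw [eval_mul, eval_C, ← coe_evalRingHom, ← coeff_map]
  congr 2
  have hid : (evalRingHom t).comp C = RingHom.id ℂ := by
    ext
    simp
  simp [Polynomial.map_map, hid]

theorem eval_tiltPoly_ofReal (M N : ℕ) (A B : ℤ → ℂ) (t : ℝ) :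
    (tiltPoly M N A B).eval (t : ℂ) = (1 + (t : ℂ) ^ 2) ^ N *
      (nullEval (fieldPoly M A * rotPoly (rotOne t) (fieldPoly N B))).coeff (M + N) := by
  have hsum : nullEval (rotPoly (rotOne t) (fieldPoly N B)) =
      ∑ n ∈ Finset.Icc (-(N : ℤ)) (N : ℤ),
        C (B n) * nullEval (rotPoly (rotOne t) (basisPoly N n)) := by
    simp only [fieldPoly, map_sum, map_smul, smul_eq_C_mul]
  rw [eval_tiltPoly, map_mul, hsum, Finset.mul_sum, finsetSum_coeff, Finset.mul_sum]
  refine Finset.sum_congr rfl fun n hn => ?_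
  have h := C_pow_mul_nullEval_rotOne_basisPoly t hn
  generalize nullEval (rotPoly (rotOne t) (basisPoly N n)) = q at h ⊢
  generalize nullEval (fieldPoly M A) = p
  generalize (X - C (t : ℂ)) ^ (N + n).toNat * (C (t : ℂ) * X + 1) ^ (N - n).toNat = r at h ⊢
  have e : p * (C (B n) * q) * C (1 + (t : ℂ) ^ 2) ^ N =
      C (B n * (Complex.I / 2) ^ n.natAbs) * (p * r) := by
    rw [C_mul]
    linear_combination p * C (B n) * h
  have e' := congrArg (fun w : ℂ[X] => w.coeff (M + N)) e
  simp only [← C_pow, coeff_mul_C, coeff_C_mul] at e'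
  rw [← e', mul_comm]

/-- At `t = i`, where the tilt degenerates, the interaction coefficient splits into a product. -/
theorem eval_tiltPoly_I {M N : ℕ} (hMN : M ≤ N) (A B : ℤ → ℂ) :
    (tiltPoly M N A B).eval Complex.I =
      (∑ n ∈ Finset.Icc (-(N : ℤ)) (N : ℤ),
        Complex.I ^ (N - n).toNat * (Complex.I / 2) ^ n.natAbs * B n) *
      ∑ m ∈ Finset.Icc (-(M : ℤ)) (M : ℤ), (-Complex.I) ^ (N + m).toNat *
        ((2 * N).choose (N - m).toNat : ℂ) * (Complex.I / 2) ^ m.natAbs * A m := by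
  have hfac : (C Complex.I * X + 1 : ℂ[X]) = C Complex.I * (X - C Complex.I) := by
    rw [mul_sub, ← C_mul, Complex.I_mul_I]
    simp
  have hcoeff : (nullEval (fieldPoly M A) * (X - C Complex.I) ^ (2 * N)).coeff (M + N) =
      ∑ m ∈ Finset.Icc (-(M : ℤ)) (M : ℤ), (-Complex.I) ^ (N + m).toNat *
        ((2 * N).choose (N - m).toNat : ℂ) * (Complex.I / 2) ^ m.natAbs * A m := by
    rw [nullEval_fieldPoly, Finset.sum_mul, finsetSum_coeff]
    refine Finset.sum_congr rfl fun m hm => ?_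
    rw [Finset.mem_Icc] at hm
    rw [mul_assoc, coeff_C_mul, show M + N = (N - m).toNat + (M + m).toNat by omega,
      coeff_X_pow_mul, sub_eq_add_neg, ← C_neg, coeff_X_add_C_pow,
      show 2 * N - (N - m).toNat = (N + m).toNat by omega]
    ring
  rw [eval_tiltPoly, Finset.sum_mul]
  refine Finset.sum_congr rfl fun n hn => ?_
  rw [Finset.mem_Icc] at hn
  rw [hfac, mul_pow, mul_left_comm ((X - C Complex.I) ^ _), ← pow_add,
    show (N + n).toNat + (N - n).toNat = 2 * N by omega, mul_left_comm, ← C_pow, coeff_C_mul,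
    hcoeff]
  ring

/-- If the order of `A` is at most that of `B`, some rotation of `B` interacts with `A`. -/
theorem exists_rotation_coeff_ne_zero {M N : ℕ} (hMN : M ≤ N) {A B : ℤ → ℂ}
    (hA : IsNontrivial M A) (hB : IsNontrivial N B) :
    ∃ T : Matrix.specialOrthogonalGroup (Fin 3) ℝ,
      (nullEval (fieldPoly M A * rotPoly T (fieldPoly N B))).coeff (M + N) ≠ 0 := by
  have hI2 : Complex.I / 2 ≠ 0 := div_ne_zero Complex.I_ne_zero two_ne_zero
  -- rotate both fields about the axis so that neither factor at `t = i` vanishes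
  obtain ⟨v, hv, hv0⟩ := exists_unit_sum_ne_zero N
    (fun n => Complex.I ^ (N - n).toNat * (Complex.I / 2) ^ n.natAbs * B n) (by
      obtain ⟨n, hn, hn0⟩ := hB
      exact ⟨n, hn, mul_ne_zero (mul_ne_zero (pow_ne_zero _ Complex.I_ne_zero)
        (pow_ne_zero _ hI2)) hn0⟩)
  obtain ⟨u, hu, hu0⟩ := exists_unit_sum_ne_zero M
    (fun m => (-Complex.I) ^ (N + m).toNat * ((2 * N).choose (N - m).toNat : ℂ) *
      (Complex.I / 2) ^ m.natAbs * A m) (by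
      obtain ⟨m, hm, hm0⟩ := hA
      refine ⟨m, hm, mul_ne_zero (mul_ne_zero (mul_ne_zero
        (pow_ne_zero _ (neg_ne_zero.mpr Complex.I_ne_zero)) ?_) (pow_ne_zero _ hI2)) hm0⟩
      rw [Finset.mem_Icc] at hm
      exact_mod_cast (Nat.choose_pos (show (N - m).toNat ≤ 2 * N by omega)).ne')
  -- the components of the fields rotated about the axis
  set A' : ℤ → ℂ := fun m => u ^ m * A m
  set B' : ℤ → ℂ := fun n => v ^ n * B n
  have hne : tiltPoly M N A' B' ≠ 0 := by
    intro h
    have := eval_tiltPoly_I hMN A' B'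
    rw [h, eval_zero] at this
    refine mul_ne_zero hv0 hu0 ?_
    rw [this]
    congr 1 <;> exact Finset.sum_congr rfl fun _ _ => by simp only [A', B']; ring
  obtain ⟨t, ht⟩ : ∃ t : ℝ, ¬(tiltPoly M N A' B').IsRoot (t : ℂ) := by
    by_contra! h
    refine hne (eq_zero_of_infinite_isRoot _
      ((Set.infinite_range_of_injective Complex.ofReal_injective).mono ?_))
    rintro _ ⟨t, rfl⟩
    exact h t
  have hcoeff : (nullEval (fieldPoly M A' * rotPoly (rotOne t) (fieldPoly N B'))).coeff (M + N) ≠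
      0 := fun h => ht (by rw [IsRoot, eval_tiltPoly_ofReal, h, mul_zero])
  -- undo the rotation of the first field by rotating the second one
  have hu' : (u⁻¹).re ^ 2 + (u⁻¹).im ^ 2 = 1 := by
    have : Complex.normSq u⁻¹ = 1 := by
      rw [Complex.normSq_inv, Complex.normSq_apply, ← sq, ← sq, hu, inv_one]
    rwa [Complex.normSq_apply, ← sq, ← sq] at this
  have hu1 : u ≠ 0 := left_ne_zero_of_mul_eq_one (re_sub_im_mul_I_mul_self hu)
  refine ⟨⟨rotThree v, rotThree_mem hv⟩ * ⟨rotOne t, rotOne_mem t⟩ *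
    ⟨rotThree u⁻¹, rotThree_mem hu'⟩, ?_⟩
  have hA' : rotPoly (rotThree u⁻¹) (fieldPoly M A') = fieldPoly M A := by
    rw [rotPoly_rotThree_fieldPoly hu']
    congr 1
    funext m
    simp only [A']
    rw [inv_zpow, inv_mul_cancel_left₀ (zpow_ne_zero m hu1)]
  change (nullEval (fieldPoly M A * rotPoly (rotThree v * rotOne t * rotThree u⁻¹)
    (fieldPoly N B))).coeff (M + N) ≠ 0
  rw [rotPoly_mul, rotPoly_mul, AlgHom.comp_apply, AlgHom.comp_apply,
    rotPoly_rotThree_fieldPoly hv, ← hA', ← map_mul, coeff_nullEval_rotThree hu'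
      ((isHomogeneous_fieldPoly M _).mul (isHomogeneous_rotPoly _ (isHomogeneous_fieldPoly N _)))]
  exact hcoeff

end Existence

/-! ### The interaction energy -/

theorem rotate_polyField (X : Space) (G : Matrix.specialOrthogonalGroup (Fin 3) ℝ)
    (P : MvPolynomial (Fin 3) ℂ) :
    Set.EqOn (rotate X G (polyField X P))
      (polyField X (rotPoly ((G⁻¹ : Matrix.specialOrthogonalGroup (Fin 3) ℝ) :
        Matrix (Fin 3) (Fin 3) ℝ) P)) {X}ᶜ :=
  polyField_comp_rot (Matrix.mem_specialOrthogonalGroup_iff.mp (G⁻¹).2).1 P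

theorem energy_eq (M N : ℕ) (A B : ℤ → ℂ) (G H : Matrix.specialOrthogonalGroup (Fin 3) ℝ) {R : ℝ}
    (hR : 0 < R) :
    energy M N A B G H R =
      (-1) ^ N * (4 * (Real.pi : ℂ) * (M + N).factorial / (R : ℂ) ^ (M + N + 1)) *
        (nullEval (rotPoly ((G⁻¹ : Matrix.specialOrthogonalGroup (Fin 3) ℝ) :
            Matrix (Fin 3) (Fin 3) ℝ) (fieldPoly M A) *
          rotPoly ((H⁻¹ : Matrix.specialOrthogonalGroup (Fin 3) ℝ) :
            Matrix (Fin 3) (Fin 3) ℝ) (fieldPoly N B))).coeff (M + N) := by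
  have h0 : R / 2 ≠ 0 := by positivity
  rw [energy, ← polyField_fieldPoly, ← polyField_fieldPoly,
    pairing_congr h0 (neg_ne_zero.mpr h0) (rotate_polyField _ G _) (rotate_polyField _ H _)]
  exact pairing_polyField hR (isHomogeneous_rotPoly _ (isHomogeneous_fieldPoly M A))
    (isHomogeneous_rotPoly _ (isHomogeneous_fieldPoly N B))

theorem energy_ne_zero (M N : ℕ) (A B : ℤ → ℂ) (G H : Matrix.specialOrthogonalGroup (Fin 3) ℝ)
    {R : ℝ} (hR : 0 < R)
    (h : (nullEval (rotPoly ((G⁻¹ : Matrix.specialOrthogonalGroup (Fin 3) ℝ) :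
            Matrix (Fin 3) (Fin 3) ℝ) (fieldPoly M A) *
          rotPoly ((H⁻¹ : Matrix.specialOrthogonalGroup (Fin 3) ℝ) :
            Matrix (Fin 3) (Fin 3) ℝ) (fieldPoly N B))).coeff (M + N) ≠ 0) :
    energy M N A B G H R ≠ 0 := by
  have hR' : (R : ℂ) ≠ 0 := by exact_mod_cast hR.ne'
  have hπ : (Real.pi : ℂ) ≠ 0 := by exact_mod_cast Real.pi_ne_zero
  have hf : ((M + N).factorial : ℂ) ≠ 0 := by exact_mod_cast (M + N).factorial_ne_zero
  rw [energy_eq M N A B G H hR]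
  exact mul_ne_zero (mul_ne_zero (pow_ne_zero _ (by norm_num))
    (div_ne_zero (mul_ne_zero (mul_ne_zero (by norm_num) hπ) hf) (pow_ne_zero _ hR'))) h

end Multipole

end

theorem mainTheorem5 (M N : ℕ) (A B : ℤ → ℂ)
    (hA : Multipole.IsRealComponents M A) (hB : Multipole.IsRealComponents N B)
    (hA0 : Multipole.IsNontrivial M A) (hB0 : Multipole.IsNontrivial N B) :
    -- the interaction formula
    (∀ R : ℝ, 0 < R →
      Integrable (Multipole.pairingDensity
        (Multipole.field M A (Multipole.axisPoint (R / 2)))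
        (Multipole.field N B (Multipole.axisPoint (-(R / 2))))) ∧
      Multipole.pairing
          (Multipole.field M A (Multipole.axisPoint (R / 2)))
          (Multipole.field N B (Multipole.axisPoint (-(R / 2)))) =
        4 * (Real.pi : ℂ) * ((M + N).factorial : ℂ) / (R : ℂ) ^ (M + N + 1) *
          ∑ m ∈ Finset.Icc (-((min M N : ℕ) : ℤ)) ((min M N : ℕ) : ℤ),
            (-1 : ℂ) ^ (N + m.natAbs) / (2 : ℂ) ^ (2 * m.natAbs) *
              ((starRingEnd ℂ) (A m) * B m)) ∧
    -- a rotation of the pole of higher order makes the interaction non-zero at all separations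
    (M ≤ N → ∃ H : Matrix.specialOrthogonalGroup (Fin 3) ℝ,
      ∀ R : ℝ, 0 < R → Multipole.energy M N A B 1 H R ≠ 0) ∧
    (N ≤ M → ∃ G : Matrix.specialOrthogonalGroup (Fin 3) ℝ,
      ∀ R : ℝ, 0 < R → Multipole.energy M N A B G 1 R ≠ 0) ∧
    -- for each orientation with non-zero interaction, the exact rate of decay
    (∀ G H : Matrix.specialOrthogonalGroup (Fin 3) ℝ,
      (∃ R₀ : ℝ, 0 < R₀ ∧ Multipole.energy M N A B G H R₀ ≠ 0) →
      ∃ c : ℝ, 0 < c ∧ ∀ R : ℝ, 0 < R →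
        ‖Multipole.energy M N A B G H R‖ = c / R ^ (M + N + 1)) := by
  open Multipole in
  refine ⟨fun R hR => ⟨?_, ?_⟩, fun hMN => ?_, fun hNM => ?_, fun G H ⟨R₀, hR₀, hE⟩ => ?_⟩
  · have h0 : R / 2 ≠ 0 := by positivity
    rw [← polyField_fieldPoly, ← polyField_fieldPoly]
    exact integrable_pairingDensity h0 (neg_ne_zero.mpr h0)
      (isPole_polyField (isHomogeneous_fieldPoly M A) _)
      (isPole_polyField (isHomogeneous_fieldPoly N B) _) (by omega)
  · rw [← polyField_fieldPoly, ← polyField_fieldPoly, pairing_polyField hR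
      (isHomogeneous_fieldPoly M A) (isHomogeneous_fieldPoly N B), coeff_nullEval_fieldPoly_mul,
      mul_right_comm, mul_comm, Finset.mul_sum]
    congr 1
    refine Finset.sum_congr rfl fun m hm => ?_
    rw [hA m (by simp only [Finset.mem_Icc] at hm ⊢; omega), pow_mul, pow_add, div_pow]
    norm_num
    ring
  · obtain ⟨T, hT⟩ := exists_rotation_coeff_ne_zero hMN hA0 hB0
    refine ⟨T⁻¹, fun R hR => energy_ne_zero M N A B 1 T⁻¹ hR ?_⟩
    rw [inv_inv, inv_one]
    change (nullEval (rotPoly 1 (fieldPoly M A) * _)).coeff _ ≠ 0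
    rwa [rotPoly_one]
  · obtain ⟨T, hT⟩ := exists_rotation_coeff_ne_zero hNM hB0 hA0
    refine ⟨T⁻¹, fun R hR => energy_ne_zero M N A B T⁻¹ 1 hR ?_⟩
    rw [inv_inv, inv_one, mul_comm, add_comm]
    change (nullEval (rotPoly 1 (fieldPoly N B) * _)).coeff _ ≠ 0
    rwa [rotPoly_one]
  · refine ⟨‖energy M N A B G H R₀‖ * R₀ ^ (M + N + 1),
      mul_pos (norm_pos_iff.mpr hE) (by positivity), fun R hR => ?_⟩
    rw [energy_eq M N A B G H hR, energy_eq M N A B G H hR₀]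
    simp only [norm_mul, norm_div, norm_pow, Complex.norm_real, Real.norm_of_nonneg hR.le,
      Real.norm_of_nonneg hR₀.le]
    field_simp
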